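/- **Conventions.** A $C^0$ Riemannian manifold $(M,g)$ is a smooth (Hausdorff, second countable) manifold $M$ of dimension $m$, possibly with boundary, with a continuous Riemannian metric $g$; $\mu_g$ is its volume measure ($\sqrt{\det(g_{ij})}\,dx^1\cdots dx^m$ in charts), and, for $M$ connected, $d_g(x,y)$ is the infimum of the $g$-lengths of $C^1$ curves from $x$ to $y$. A distance function $d$ on the set $M$ is *locally compatible* with $g$ if every $p\in M$ lies in a set $U\subseteq M$, open in the manifold $M$ and open for $d$, such that $d=d_g$ on $U\times U$. An *$m$-dimensional current* on a complete metric space $X$ is a multilinear real functional $T(f,\pi_1,\dots,\pi_m)$ of a bounded Lipschitz function $f$ and Lipschitz functions $\pi_i$ on $X$ such that: (i) $T(f,\pi_1^j,\dots,\pi_m^j)\to T(f,\pi_1,\dots,\pi_m)$ whenever $\pi_i^j\to\pi_i$ pointwise with uniformly bounded Lipschitz constants; (ii) $T(f,\pi_1,\dots,\pi_m)=0$ if some $\pi_i$ is constant on a neighborhood of $\{f\ne0\}$; (iii) there is a finite Borel measure $\mu$ on $X$ with $|T(f,\pi_1,\dots,\pi_m)|\le\int_X|f|\,d\mu$ whenever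 all $\operatorname{Lip}(\pi_i)\le1$. The *mass measure* $\|T\|$ is the least finite Borel measure $\mu$ as in (iii), and $\mathbb M(T)=\|T\|(X)$; the same notation is used for any functional $T$ of such tuples. For $m\ge1$ put $\partial T(f,\pi_1,\dots,\pi_{m-1})=T(1,f,\pi_1,\dots,\pi_{m-1})$ and $(T\llcorner du)(f,\pi_1,\dots,\pi_{m-1})=T(f,u,\pi_1,\dots,\pi_{m-1})$ for $u$ Lipschitz; for $m=0$ put $\partial T=0$. A current $T$ is *integer rectifiable* if $T=\sum_{i\ge1}T_i$ with $\sum_i\mathbb M(T_i)=\mathbb M(T)$, where $T_i(f,\pi_1,\dots,\pi_m)=\int_{K_i}\theta_i\,(f\circ\varphi_i)\,d(\pi_1\circ\varphi_i)\wedge\dots\wedge d(\pi_m\circ\varphi_i)$ for compact sets $K_i\subset\mathbb R^m$, functions $\theta_i\in L^1(\mathbb R^m;\mathbb Z)$ supported in $K_i$, and maps $\varphi_i:K_i\to X$ bi-Lipschitz onto their images. It is *integral* if moreover $\partial T$ is a current. $(M,d,T)$ is an *integral current space* if $T$ is an integral $m$-current on the completion $\bar M$ of $(M,d)$ and $M$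 is the set of points $p\in\bar M$ with $\liminf_{r\to0}r^{-m}\|T\|(B(p,r))>0$. **Statement.** There is a universal constant $\gamma_0>0$ such that the following holds. Let $(M,g)$ be a connected, oriented $C^0$ Riemannian manifold of dimension $m$, possibly with boundary, and let $d$ be a distance function on $M$ locally compatible with $g$. Suppose that $(M,d,T)$ is an integral current space whose current is given by integration, $$T(f,\pi_1,\dots,\pi_m)=\int_M f\,d\pi_1\wedge\dots\wedge d\pi_m$$ (all these integrals being convergent). Then: (a) $\|T\|=\mu_g$ as Borel measures on $M$, and $\mathbb M(T)=\mu_g(M)$. (b) Let $m\ge1$ and $\gamma\in[0,\gamma_0]$. Let $u:M\to\mathbb R$ be $(1+\gamma)$-Lipschitz with respect to $d$, and let $S\subset M$ be a closed set with $\mu_g(S)=0$ such that $u$ is $C^1$ on $M\setminus S$ with $(1+\gamma)^{-1}\le|\nabla u|_g\le1+\gamma$ there. Then (with $u$ extended to $\bar M$ by continuity) $$(1+\gamma)^{-1}\mu_g\le\|T\llcorner du\|\le(1+\gamma)\,\mu_g$$ as Borel measures on $M$. In particular, $\|T\llcorner du\|=\mu_g$ if $\gamma=0$. -/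

import Mathlib

open scoped Manifold ContDiff Topology ENNReal NNReal
open MeasureTheory Bundle

noncomputable section

/-! ### Currents on metric spaces in the sense of Ambrosio and Kirchheim -/

namespace MetricCurrent

section

variable (X : Type*) [MetricSpace X]

/-- The vector space of Lipschitz functions `X → ℝ`. -/
def Lip : Submodule ℝ (X → ℝ) where
  carrier := {f | ∃ K : ℝ≥0, LipschitzWith K f}
  zero_mem' := ⟨0, LipschitzWith.const 0⟩
  add_mem' := by
    rintro f g ⟨K, hf⟩ ⟨L, hg⟩
    exact ⟨K + L, hf.add hg⟩
  smul_mem' := by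
    rintro c f ⟨K, hf⟩
    exact ⟨‖c‖₊ * K, (lipschitzWith_smul c).comp hf⟩

/-- The vector space of bounded Lipschitz functions `X → ℝ`. -/
def BLip : Submodule ℝ (X → ℝ) where
  carrier := {f | (∃ K : ℝ≥0, LipschitzWith K f) ∧ ∃ C : ℝ, ∀ x, |f x| ≤ C}
  zero_mem' := ⟨⟨0, LipschitzWith.const 0⟩, 0, fun x => by simp⟩
  add_mem' := by
    rintro f g ⟨⟨K, hf⟩, C, hC⟩ ⟨⟨L, hg⟩, D, hD⟩
    exact ⟨⟨K + L, hf.add hg⟩, C + D, fun x => (abs_add_le _ _).trans (add_le_add (hC x) (hD x))⟩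
  smul_mem' := by
    rintro c f ⟨⟨K, hf⟩, C, hC⟩
    refine ⟨⟨‖c‖₊ * K, (lipschitzWith_smul c).comp hf⟩, |c| * C, fun x => ?_⟩
    have h : |(c • f) x| = |c| * |f x| := by simp [abs_mul]
    rw [h]
    exact mul_le_mul_of_nonneg_left (hC x) (abs_nonneg c)

/-- Real-valued functionals on tuples `(f, π₁, …, πₘ)` with `f` bounded Lipschitz and all `πᵢ`
Lipschitz. The tuple stands for the form `f dπ₁ ∧ … ∧ dπₘ`. -/
abbrev Functional (m : ℕ) : Type _ := BLip X → (Fin m → Lip X) → ℝ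

variable {X}

/-- The constant function one. -/
def oneBLip : BLip X := ⟨fun _ => 1, ⟨0, LipschitzWith.const 1⟩, 1, fun x => by simp⟩

/-- A bounded Lipschitz function, seen as a Lipschitz function. -/
def BLip.toLip (f : BLip X) : Lip X := ⟨f.1, f.2.1⟩

/-- The boundary `∂T (f, π₁, …) = T (1, f, π₁, …)`; the boundary of a `0`-dimensional functional
is the zero `0`-dimensional functional. -/
def boundary : ∀ {m : ℕ}, Functional X m → Functional X (m - 1)
  | 0, _ => fun _ _ => 0
  | _ + 1, T => fun f p => T oneBLip (Fin.cons (BLip.toLip f) p)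

/-- The restriction `(T ⌞ du) (f, π₁, …) = T (f, u, π₁, …)`, meaningful in dimension `m ≥ 1`. -/
def restrictD : ∀ {m : ℕ}, Functional X m → Lip X → Functional X (m - 1)
  | 0, _, _ => fun _ _ => 0
  | _ + 1, T, u => fun f p => T f (Fin.cons u p)

variable [MeasurableSpace X] {m : ℕ}

/-- `|T (f, π₁, …, πₘ)| ≤ ∫ |f| dμ` whenever `Lip πᵢ ≤ 1` for all `i`. -/
def MassBound (T : Functional X m) (μ : Measure X) : Prop :=
  ∀ (f : BLip X) (p : Fin m → Lip X), (∀ i, LipschitzWith 1 (p i : X → ℝ)) →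
    |T f p| ≤ ∫ x, |(f : X → ℝ) x| ∂μ

/-- The mass measure `‖T‖`: the minimal finite Borel measure with the mass bound. -/
def massMeasure (T : Functional X m) : Measure X :=
  sInf {μ : Measure X | IsFiniteMeasure μ ∧ MassBound T μ}

/-- The mass `𝕄(T) = ‖T‖(X)`. -/
def mass (T : Functional X m) : ℝ≥0∞ := massMeasure T Set.univ

/-- `T` is an `m`-dimensional current (on a complete metric space `X`). -/
structure IsCurrent (T : Functional X m) : Prop where
  multilinear : ∃ L : BLip X →ₗ[ℝ] MultilinearMap ℝ (fun _ : Fin m => Lip X) ℝ,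
    ∀ f p, T f p = L f p
  continuity : ∀ (f : BLip X) (p : Fin m → Lip X) (ρ : ℕ → Fin m → Lip X) (K : ℝ≥0),
    (∀ j i, LipschitzWith K (ρ j i : X → ℝ)) →
    (∀ i x, Filter.Tendsto (fun j => (ρ j i : X → ℝ) x) Filter.atTop (𝓝 ((p i : X → ℝ) x))) →
    Filter.Tendsto (fun j => T f (ρ j)) Filter.atTop (𝓝 (T f p))
  locality : ∀ (f : BLip X) (p : Fin m → Lip X),
    (∃ i, ∃ U : Set X, IsOpen U ∧ {x | (f : X → ℝ) x ≠ 0} ⊆ U ∧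
      ∃ c : ℝ, ∀ x ∈ U, (p i : X → ℝ) x = c) → T f p = 0
  finite_mass : ∃ μ : Measure X, IsFiniteMeasure μ ∧ MassBound T μ

/-- The functional
`(f, π) ↦ ∫_K θ (f ∘ φ) d(π₁ ∘ φ) ∧ … ∧ d(πₘ ∘ φ)` for `K ⊆ ℝᵐ` and `φ : K → X` Lipschitz (the
values of `φ` outside `K` do not matter). The derivatives within `K` exist and are unique at almost
every point of `K`. -/
def parametrized (K : Set (EuclideanSpace ℝ (Fin m))) (θ : EuclideanSpace ℝ (Fin m) → ℤ)
    (φ : EuclideanSpace ℝ (Fin m) → X) : Functional X m := fun f p =>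
  ∫ y in K, (θ y : ℝ) * (f : X → ℝ) (φ y) *
    (Matrix.of fun i j : Fin m =>
      fderivWithin ℝ (fun z => (p i : X → ℝ) (φ z)) K y (EuclideanSpace.single j 1)).det

/-- Integer rectifiable `m`-currents. For `m = 0` these are the sums of integer multiples of point
evaluations. -/
def IsIntegerRectifiable (T : Functional X m) : Prop :=
  IsCurrent T ∧
  ∃ (K : ℕ → Set (EuclideanSpace ℝ (Fin m))) (θ : ℕ → EuclideanSpace ℝ (Fin m) → ℤ)
    (φ : ℕ → EuclideanSpace ℝ (Fin m) → X),
    (∀ i, IsCompact (K i)) ∧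
    (∀ i, Integrable (fun y => (θ i y : ℝ))) ∧
    (∀ i, Function.support (θ i) ⊆ K i) ∧
    (∀ i, ∃ L : ℝ≥0, LipschitzOnWith L (φ i) (K i) ∧
      ∀ y ∈ K i, ∀ z ∈ K i, dist y z ≤ L * dist (φ i y) (φ i z)) ∧
    (∀ f p, HasSum (fun i => parametrized (K i) (θ i) (φ i) f p) (T f p)) ∧
    ∑' i, mass (parametrized (K i) (θ i) (φ i)) = mass T

/-- Integral currents: integer rectifiable currents whose boundary is a current. -/
def IsIntegralCurrent (T : Functional X m) : Prop :=
  IsIntegerRectifiable T ∧ IsCurrent (boundary T)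

/-- `set T`: the points of positive lower `m`-density of the mass measure of the
`m`-dimensional `T`. -/
def canonicalSet (T : Functional X m) : Set X :=
  {p | 0 < Filter.liminf (fun r : ℝ => massMeasure T (Metric.ball p r) / ENNReal.ofReal (r ^ m))
    (𝓝[>] 0)}

end

/-- The metric completion carries its Borel σ-algebra. -/
instance completionMeasurableSpace (X : Type*) [MetricSpace X] :
    MeasurableSpace (UniformSpace.Completion X) := borel _

instance completionBorelSpace (X : Type*) [MetricSpace X] :
    BorelSpace (UniformSpace.Completion X) := ⟨rfl⟩

/-- `(X, d, T)` is an integral current space: `T` is an integral current on the completion of `X`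
and `set T = X`. -/
def IsIntegralCurrentSpace (X : Type*) [MetricSpace X] {m : ℕ}
    (T : Functional (UniformSpace.Completion X) m) : Prop :=
  IsIntegralCurrent T ∧ canonicalSet T = Set.range ((↑) : X → UniformSpace.Completion X)

/-- The unique Lipschitz extension to the completion of a Lipschitz function. -/
def extendLip {X : Type*} [MetricSpace X] (u : X → ℝ) (hu : ∃ K : ℝ≥0, LipschitzWith K u) :
    Lip (UniformSpace.Completion X) :=
  ⟨UniformSpace.Completion.extension u, hu.imp fun _ h => h.completion_extension⟩

end MetricCurrent

/-! ### Continuous Riemannian metrics on oriented manifolds -/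

namespace C0Riemannian

open MetricCurrent

/-- The set `M`, equipped with a distance function `d` (and the topology of `d`). -/
def WithMetric (M : Type*) (_d : MetricSpace M) : Type _ := M

instance {M : Type*} (d : MetricSpace M) : MetricSpace (WithMetric M d) := d

/-- The identity map from `M` to `(M, d)`. -/
def toMetric {M : Type*} (d : MetricSpace M) : M ≃ WithMetric M d := Equiv.refl M

/-- The inclusion of `M` into the completion of `(M, d)`. -/
def toCompletion {M : Type*} (d : MetricSpace M) (x : M) :
    UniformSpace.Completion (WithMetric M d) := (toMetric d x : WithMetric M d)

section

variable {m : ℕ} {H : Type*} [TopologicalSpace H]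
  (I : ModelWithCorners ℝ (EuclideanSpace ℝ (Fin m)) H)
  {M : Type*} [TopologicalSpace M] [ChartedSpace H M]

instance (x : M) : FiniteDimensional ℝ (TangentSpace I x) :=
  inferInstanceAs (FiniteDimensional ℝ (EuclideanSpace ℝ (Fin m)))

instance (x : M) : Fact (Module.finrank ℝ (TangentSpace I x) = m) :=
  ⟨finrank_euclideanSpace_fin (𝕜 := ℝ) (n := m)⟩

variable (M) in
/-- An orientation of `M`: an orientation of every tangent space, locally constant in the local
trivializations of the tangent bundle. -/
structure ManifoldOrientation [IsManifold I ∞ M] where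
  at' : ∀ x : M, Orientation ℝ (TangentSpace I x) (Fin m)
  locally_constant : ∀ x₀ : M, ∃ o : Orientation ℝ (EuclideanSpace ℝ (Fin m)) (Fin m),
    ∀ᶠ x in 𝓝 x₀,
      ∃ hx : x ∈ (trivializationAt (EuclideanSpace ℝ (Fin m)) (TangentSpace I) x₀).baseSet,
        Orientation.map (Fin m) ((trivializationAt (EuclideanSpace ℝ (Fin m)) (TangentSpace I)
          x₀).continuousLinearEquivAt ℝ x hx).toLinearEquiv (at' x) = o

/-- The `j`-th coordinate vector `∂ⱼ ∈ T_x M` of the chart at `x₀`, for `x` in its domain. -/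
def coordVector [IsManifold I ∞ M] (x₀ x : M) (j : Fin m) : TangentSpace I x :=
  (trivializationAt (EuclideanSpace ℝ (Fin m)) (TangentSpace I) x₀).symmL ℝ x
    (EuclideanSpace.single j 1)

/-- The vectors of the standard basis of `T_x M` (the coordinate vectors of the chart at `x`). -/
def stdVector (x : M) (j : Fin m) : TangentSpace I x :=
  (EuclideanSpace.single j 1 : EuclideanSpace ℝ (Fin m))

variable [RiemannianBundle (fun x : M => TangentSpace I x)]

/-- `√(det gᵢⱼ)` at the point `x`, in the chart at `x₀`. -/
def volumeDensity [IsManifold I ∞ M] (x₀ x : M) : ℝ :=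
  Real.sqrt (Matrix.of fun i j : Fin m =>
    inner ℝ (coordVector I x₀ x i) (coordVector I x₀ x j)).det

/-- The Riemannian measure on the domain of the chart at `x₀`, namely `√(det gᵢⱼ) dx¹ … dxᵐ`. -/
def chartVolume [IsManifold I ∞ M] [MeasurableSpace M] (x₀ : M) : Measure M :=
  ((volume.restrict (extChartAt I x₀).target).withDensity
    (fun y => ENNReal.ofReal (volumeDensity I x₀ ((extChartAt I x₀).symm y)))).map
      (extChartAt I x₀).symm

variable (M) in
/-- The Riemannian volume measure `μ_g`. The measures `chartVolume I x₀` agree on overlaps of chart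
domains; the measure on `M` that restricts to each of them is their supremum. -/
def riemannianVolume [IsManifold I ∞ M] [MeasurableSpace M] : Measure M :=
  ⨆ x₀ : M, chartVolume I x₀

/-- The function `h` with `dπ₁ ∧ … ∧ dπₘ = h Ω_g` at `x`, where `Ω_g` is the oriented Riemannian
volume form: both sides are evaluated on the standard basis of `T_x M`. -/
def formCoeff [IsManifold I ∞ M] (o : ManifoldOrientation I M) (p : Fin m → M → ℝ) (x : M) : ℝ :=
  (Matrix.of fun i j : Fin m =>
      (mfderiv I 𝓘(ℝ, ℝ) (p i) x : TangentSpace I x →L[ℝ] ℝ) (stdVector I x j)).det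
    / (o.at' x).volumeForm (stdVector I x)

/-- The Riemannian gradient `∇u`. -/
def riemannianGradient (u : M → ℝ) (x : M) : TangentSpace I x :=
  letI := FiniteDimensional.complete ℝ (TangentSpace I x)
  (InnerProductSpace.toDual ℝ (TangentSpace I x)).symm (mfderiv I 𝓘(ℝ, ℝ) u x)

/-- The distance `d` on `M` and the Riemannian metric are locally compatible: every point has a
neighborhood, open in `M` and open for `d`, on which `d` equals the Riemannian distance `d_g`. -/
def LocallyCompatible (d : MetricSpace M) : Prop :=
  ∀ p : M, ∃ U : Set M, p ∈ U ∧ IsOpen U ∧ IsOpen (toMetric d '' U) ∧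
    ∀ x ∈ U, ∀ y ∈ U, edist (toMetric d x) (toMetric d y) = Manifold.riemannianEDist I x y

/-- `T` is given by integration over `M`: `T (f, π₁, …, πₘ) = ∫_M f dπ₁ ∧ … ∧ dπₘ`, all these
integrals being convergent. -/
def IsCanonicalCurrent [IsManifold I ∞ M] [MeasurableSpace M] (o : ManifoldOrientation I M)
    (d : MetricSpace M) (T : Functional (UniformSpace.Completion (WithMetric M d)) m) : Prop :=
  ∀ (f : BLip (UniformSpace.Completion (WithMetric M d)))
    (p : Fin m → Lip (UniformSpace.Completion (WithMetric M d))),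
    Integrable (fun x : M => f.1 (toCompletion d x) *
      formCoeff I o (fun i => (p i).1 ∘ toCompletion d) x) (riemannianVolume I M) ∧
    T f p = ∫ x : M, f.1 (toCompletion d x) *
      formCoeff I o (fun i => (p i).1 ∘ toCompletion d) x ∂(riemannianVolume I M)

end

end C0Riemannian

end

open C0Riemannian MetricCurrent

/-!
The mass measures are computed by comparing determinants of differentials with the volume form.

*Upper bounds.* Write `dq₁ ∧ … ∧ dqₘ = h Ω_g`. The coefficient `h` is the oriented volume of the
gradients `∇qᵢ` (`formCoeff_eq_volumeForm`), so Hadamard's inequality gives `|h| ≤ ∏ |∇qᵢ|`. If `qᵢ`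
is `Kᵢ`-Lipschitz for `d`, hence locally for `d_g`, then `|∇qᵢ| ≤ Kᵢ` at interior points: follow
coordinate lines (`norm_covector_le_of_isInteriorPoint`). Where `qᵢ` is not differentiable its
`mfderiv` is zero, so no theorem of Rademacher type is needed. The boundary is null for `μ_g`
because the range of the model is convex. Hence `|T (f, q)| ≤ ∏ Kᵢ ∫ |f| dμ_g`
(`abs_apply_le_of_lipschitzWith`), which bounds both `‖T‖` and `‖T ⌞ du‖` from above.

*Lower bounds.* Let `μ` be any finite measure satisfying the mass bound. Fix `p` and `t < 1`, and
take an orthonormal basis of `T_p M`. In the chart at `p`, the linear functionals dual to `t` times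
the basis are `1`-Lipschitz near `p`, by continuity of `g` and because short curves stay near `p`;
by McShane's extension they are germs of `1`-Lipschitz functions on the completion
(`exists_lip_eq_chart`). Their form has coefficient of absolute value `tᵐ` at `p`. For
`T ⌞ du`, choose the first basis vector along `∇u`, and use only the others together with `u`: the
absolute value is `|∇u| tᵐ⁻¹`. The coefficient is continuous and keeps its sign near `p`, so testing
with `f ≥ 0` supported near `p` shows that `μ` dominates almost the full multiple of `μ_g` there
(`exists_nhds_volume_le_of_lt_formCoeff`). Countably many such neighbourhoods suffice, and then the
constant tends to its limit (`ofReal_smul_volume_le_of_forall_exists_nhds`).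

The two bounds identify the infimum that defines the mass measure. Since `d` induces the topology of
`M` and `M` is locally compact, `M` is open in its completion, so Borel sets of `M` stay Borel there
and the measure pushed forward from `M` gives no mass to the added points.
-/

/-! ### Determinants and volume forms -/

namespace Orientation

variable {m : ℕ} {V : Type*} [NormedAddCommGroup V] [InnerProductSpace ℝ V]
  [Fact (Module.finrank ℝ V = m)]

omit [Fact (Module.finrank ℝ V = m)] in
lemma exists_orthonormalBasis_fin [FiniteDimensional ℝ V] (h : Module.finrank ℝ V = m) :
    Nonempty (OrthonormalBasis (Fin m) ℝ V) :=
  ⟨(stdOrthonormalBasis ℝ V).reindex (finCongr h)⟩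

/-- The signs of the two volume forms cancel, so the identity can be checked on the determinants
with respect to any orthonormal basis. -/
lemma det_inner_eq_volumeForm_mul_volumeForm [FiniteDimensional ℝ V]
    (o : Orientation ℝ V (Fin m)) (a v : Fin m → V) :
    (Matrix.of fun i j => inner ℝ (a i) (v j)).det = o.volumeForm a * o.volumeForm v := by
  obtain ⟨b⟩ := exists_orthonormalBasis_fin (V := V) (m := m) Fact.out
  have key : o.volumeForm a * o.volumeForm v = b.toBasis.det a * b.toBasis.det v := by
    by_cases hb : b.toBasis.orientation = o
    · rw [o.volumeForm_robust b hb]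
    · rw [o.volumeForm_robust_neg b hb]
      simp
  rw [key, Module.Basis.det_apply, Module.Basis.det_apply,
    ← Matrix.det_transpose (b.toBasis.toMatrix a), ← Matrix.det_mul]
  congr 1
  ext i j
  simp only [Matrix.mul_apply, Matrix.transpose_apply, Matrix.of_apply, Module.Basis.toMatrix_apply,
    OrthonormalBasis.coe_toBasis_repr_apply, OrthonormalBasis.repr_apply_apply]
  rw [← b.sum_inner_mul_inner]
  exact Finset.sum_congr rfl fun k _ => by rw [real_inner_comm]

lemma volumeForm_basis_ne_zero (o : Orientation ℝ V (Fin m)) (v : Module.Basis (Fin m) ℝ V) :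
    o.volumeForm v ≠ 0 := by
  have : FiniteDimensional ℝ V := v.finiteDimensional_of_finite
  obtain ⟨b⟩ := exists_orthonormalBasis_fin (V := V) (m := m) Fact.out
  have h := o.volumeForm_robust' b v
  have h2 : b.toBasis.det v ≠ 0 := (b.toBasis.isUnit_det v).ne_zero
  intro h0
  rw [h0, abs_zero] at h
  exact h2 (abs_eq_zero.1 h.symm)

/-- The determinant of covectors on a basis, divided by the volume of that basis, is the volume of
the dual vectors; in particular it does not depend on the basis. -/
lemma det_div_volumeForm_eq [FiniteDimensional ℝ V] [CompleteSpace V]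
    (o : Orientation ℝ V (Fin m))
    (α : Fin m → V →L[ℝ] ℝ) (v : Module.Basis (Fin m) ℝ V) :
    (Matrix.of fun i j => α i (v j)).det / o.volumeForm v =
      o.volumeForm fun i => (InnerProductSpace.toDual ℝ V).symm (α i) := by
  rw [div_eq_iff (o.volumeForm_basis_ne_zero v), ← det_inner_eq_volumeForm_mul_volumeForm]
  congr 1
  ext i j
  simp

/-- Up to a sign that depends only on the orientation that `e` transports to the model space, the
volume of a basis is the square root of its Gram determinant. -/
lemma volumeForm_eq_sign_mul_sqrt [FiniteDimensional ℝ V] {E : Type*} [AddCommGroup E]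
    [Module ℝ E]
    (o : Orientation ℝ V (Fin m)) (Φ : V ≃ₗ[ℝ] E) (e : Module.Basis (Fin m) ℝ E) :
    o.volumeForm (fun j => Φ.symm (e j)) =
      (open Classical in if Orientation.map (Fin m) Φ o = e.orientation then 1 else -1) *
        √(Matrix.of fun i j => inner ℝ (Φ.symm (e i)) (Φ.symm (e j))).det := by
  classical
  rw [det_inner_eq_volumeForm_mul_volumeForm o, Real.sqrt_mul_self_eq_abs]
  set v : Module.Basis (Fin m) ℝ V := e.map Φ.symm with hv
  have hve : (fun j => Φ.symm (e j)) = v := by ext j; simp [hv]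
  rw [hve]
  have hiff : Orientation.map (Fin m) Φ o = e.orientation ↔ o = v.orientation := by
    rw [hv, Module.Basis.orientation_map, ← Orientation.map_symm, Equiv.eq_symm_apply]
  obtain ⟨b⟩ := exists_orthonormalBasis_fin (V := V) (m := m) Fact.out
  have hdet : b.toBasis.det v ≠ 0 := (b.toBasis.isUnit_det v).ne_zero
  have hbv := Module.Basis.orientation_eq_iff_det_pos b.toBasis v
  have hcard : Fintype.card (Fin m) = Module.finrank ℝ V := by
    rw [Fintype.card_fin, (Fact.out : Module.finrank ℝ V = m)]
  by_cases h : o = v.orientation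
  · rw [if_pos (hiff.2 h), one_mul, eq_comm, abs_eq_self]
    by_cases hb : b.toBasis.orientation = o
    · rw [o.volumeForm_robust b hb]
      exact (hbv.1 (hb.trans h)).le
    · rw [o.volumeForm_robust_neg b hb]
      have : ¬ 0 < b.toBasis.det v := fun h' => hb ((hbv.2 h').trans h.symm)
      simpa using this
  · rw [if_neg (fun h' => h (hiff.1 h')), neg_one_mul, eq_comm, neg_eq_iff_eq_neg, abs_eq_neg_self]
    by_cases hb : b.toBasis.orientation = o
    · rw [o.volumeForm_robust b hb]
      have : ¬ 0 < b.toBasis.det v := fun h' => h (hb.symm.trans (hbv.2 h'))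
      simpa using this
    · rw [o.volumeForm_robust_neg b hb]
      have h1 := (b.toBasis.orientation.eq_or_eq_neg o hcard).resolve_left hb
      have h2 := (v.orientation.eq_or_eq_neg o hcard).resolve_left (fun h' => h h'.symm)
      simpa using (hbv.1 (h1.trans h2.symm)).le

end Orientation

/-! ### Comparison of measures by Lipschitz functions -/

namespace MeasureTheory

/-- The distance to the complement of an open set, capped at height one. -/
lemma exists_lipschitz_approx_indicator {X : Type*} [MetricSpace X] {O : Set X} (hO : IsOpen O) :
    ∃ f : ℕ → BLip X, (∀ n x, 0 ≤ (f n).1 x) ∧ (∀ n x, (f n).1 x ≠ 0 → x ∈ O) ∧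
      (∀ x, Monotone fun n => (f n).1 x) ∧
      ∀ x, Filter.Tendsto (fun n => (f n).1 x) Filter.atTop (𝓝 (O.indicator 1 x)) := by
  rcases Set.eq_empty_or_nonempty Oᶜ with h | hne
  · obtain rfl : O = Set.univ := Set.compl_empty_iff.1 h
    refine ⟨fun _ => oneBLip, fun _ _ => zero_le_one, fun _ _ _ => Set.mem_univ _,
      fun _ => monotone_const, fun x => ?_⟩
    simp [oneBLip]
  have hcl : IsClosed Oᶜ := hO.isClosed_compl
  have hnn : ∀ (n : ℕ) x, 0 ≤ min (1 : ℝ) (n * Metric.infDist x Oᶜ) := fun n x =>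
    le_min zero_le_one (mul_nonneg n.cast_nonneg Metric.infDist_nonneg)
  refine ⟨fun n => ⟨fun x => min 1 (n * Metric.infDist x Oᶜ), ⟨n, ?_⟩, 1, fun x => ?_⟩,
    hnn, fun n x hx => ?_, fun x a b hab => ?_, fun x => ?_⟩
  · have h1 : LipschitzWith ((n : ℝ≥0) * 1) (fun x => (n : ℝ) * Metric.infDist x Oᶜ) := by
      have := (lipschitzWith_smul (n : ℝ)).comp (Metric.lipschitz_infDist_pt Oᶜ)
      simpa [Function.comp_def] using this
    simpa using h1.const_min 1
  · rw [abs_of_nonneg (hnn n x)]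
    exact min_le_left _ _
  · by_contra hxO
    apply hx
    have : Metric.infDist x Oᶜ = 0 := Metric.infDist_zero_of_mem hxO
    simp [this]
  · have : (a : ℝ) ≤ b := by exact_mod_cast hab
    exact min_le_min_left _ (mul_le_mul_of_nonneg_right this Metric.infDist_nonneg)
  · by_cases hx : x ∈ O
    · rw [Set.indicator_of_mem hx]
      have hpos : 0 < Metric.infDist x Oᶜ :=
        (hcl.notMem_iff_infDist_pos hne).1 (fun h => h hx)
      obtain ⟨N, hN⟩ := exists_nat_gt (1 / Metric.infDist x Oᶜ)
      refine tendsto_const_nhds.congr' ?_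
      filter_upwards [Filter.eventually_ge_atTop N] with n hn
      have : (N : ℝ) ≤ n := by exact_mod_cast hn
      rw [div_lt_iff₀ hpos] at hN
      exact (min_eq_left (hN.le.trans (mul_le_mul_of_nonneg_right this hpos.le))).symm
    · rw [Set.indicator_of_notMem hx]
      have : Metric.infDist x Oᶜ = 0 := Metric.infDist_zero_of_mem hx
      simp [this]

/-- A comparison of integrals of nonnegative Lipschitz functions supported in an open set `W`
passes to open subsets of `W` by monotone convergence and to Borel subsets by outer regularity. -/
lemma measure_le_of_forall_lipschitz {X : Type*} [MetricSpace X] [MeasurableSpace X] [BorelSpace X]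
    {ν μ : Measure X} [IsFiniteMeasure μ] {W : Set X} (hW : IsOpen W)
    (h : ∀ f : BLip X, (∀ x, 0 ≤ f.1 x) → (∀ x, f.1 x ≠ 0 → x ∈ W) →
      ∫⁻ x, ENNReal.ofReal (f.1 x) ∂ν ≤ ∫⁻ x, ENNReal.ofReal (f.1 x) ∂μ)
    {s : Set X} (hs : s ⊆ W) : ν s ≤ μ s := by
  have hopen : ∀ O : Set X, IsOpen O → O ⊆ W → ν O ≤ μ O := by
    intro O hO hOW
    obtain ⟨f, h0, hsupp, hmono, hlim⟩ := exists_lipschitz_approx_indicator hO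
    have hlint : ∀ ρ : Measure X, Filter.Tendsto (fun n => ∫⁻ x, ENNReal.ofReal ((f n).1 x) ∂ρ)
        Filter.atTop (𝓝 (ρ O)) := by
      intro ρ
      rw [← lintegral_indicator_one hO.measurableSet]
      refine lintegral_tendsto_of_tendsto_of_monotone (fun n => ?_) (ae_of_all _ fun x => ?_)
        (ae_of_all _ fun x => ?_)
      · obtain ⟨K, hK⟩ := (f n).2.1
        exact (ENNReal.measurable_ofReal.comp hK.continuous.measurable).aemeasurable
      · exact fun a b hab => ENNReal.ofReal_le_ofReal (hmono x hab)
      · have := (ENNReal.continuous_ofReal.tendsto _).comp (hlim x)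
        have hind : ENNReal.ofReal (O.indicator 1 x) = O.indicator 1 x := by
          by_cases hx : x ∈ O
          · simp [Set.indicator_of_mem hx]
          · simp [Set.indicator_of_notMem hx]
        rwa [hind] at this
    exact le_of_tendsto_of_tendsto' (hlint ν) (hlint μ)
      fun n => h (f n) (h0 n) fun x hx => hOW (hsupp n x hx)
  rw [s.measure_eq_iInf_isOpen μ]
  refine le_iInf₂ fun O hsO => le_iInf fun hO => ?_
  calc ν s ≤ ν (O ∩ W) := measure_mono (Set.subset_inter hsO hs)
    _ ≤ μ (O ∩ W) := hopen _ (hO.inter hW) Set.inter_subset_right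
    _ ≤ μ O := measure_mono Set.inter_subset_left

/-- Domination of measures on the pieces of a countable cover, up to a null set, is global. -/
lemma Measure.le_of_countable_cover {X ι : Type*} [MeasurableSpace X] [Countable ι]
    {ν μ : Measure X} (W : ι → Set X) (hW : ∀ i, MeasurableSet (W i))
    (hnull : ν (⋃ i, W i)ᶜ = 0)
    (h : ∀ i s, s ⊆ W i → ν s ≤ μ s) : ν ≤ μ := by
  rw [Measure.le_iff]
  intro s hs
  rcases isEmpty_or_nonempty ι with hι | hι
  · rw [Set.iUnion_of_empty, Set.compl_empty] at hnull
    simp [measure_mono_null (Set.subset_univ s) hnull]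
  obtain ⟨e, he⟩ := exists_surjective_nat ι
  set D : ℕ → Set X := disjointed fun n => W (e n)
  have hD : ∀ n, MeasurableSet (D n) := MeasurableSet.disjointed fun n => hW _
  have hDU : ⋃ n, D n = ⋃ i, W i := by
    rw [iUnion_disjointed]
    exact he.iUnion_comp W
  have hdisj : Pairwise fun i j => Disjoint (s ∩ D i) (s ∩ D j) := fun i j hij =>
    (disjoint_disjointed _ hij).mono Set.inter_subset_right Set.inter_subset_right
  calc ν s ≤ ν (s ∩ ⋃ n, D n) + ν (⋃ i, W i)ᶜ := by
        refine (measure_mono fun x hx => ?_).trans (measure_union_le _ _)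
        rw [hDU]
        by_cases hxW : x ∈ ⋃ i, W i
        · exact Or.inl ⟨hx, hxW⟩
        · exact Or.inr hxW
    _ = ∑' n, ν (s ∩ D n) := by
        rw [hnull, add_zero, Set.inter_iUnion,
          measure_iUnion hdisj fun n => hs.inter (hD n)]
    _ ≤ ∑' n, μ (s ∩ D n) := ENNReal.tsum_le_tsum fun n =>
        h (e n) _ (Set.inter_subset_right.trans (disjointed_subset _ n))
    _ = μ (⋃ n, s ∩ D n) := (measure_iUnion hdisj fun n => hs.inter (hD n)).symm
    _ ≤ μ s := measure_mono (Set.iUnion_subset fun n => Set.inter_subset_left)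

end MeasureTheory

/-! ### Coordinate fields and differentials -/

namespace C0Riemannian

section

variable {m : ℕ} {H : Type*} [TopologicalSpace H]
  {I : ModelWithCorners ℝ (EuclideanSpace ℝ (Fin m)) H}
  {M : Type*} [TopologicalSpace M] [ChartedSpace H M] [IsManifold I ∞ M]
  [RiemannianBundle (fun x : M => TangentSpace I x)]

omit [RiemannianBundle (fun x : M => TangentSpace I x)] in
lemma continuousAt_symmL_trivializationAt (p : M) (w : EuclideanSpace ℝ (Fin m)) :
    ContinuousAt (fun y : M =>
      (⟨y, (trivializationAt (EuclideanSpace ℝ (Fin m)) (TangentSpace I) p).symmL ℝ y w⟩ :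
        TotalSpace (EuclideanSpace ℝ (Fin m)) (TangentSpace I : M → Type _))) p := by
  rw [FiberBundle.continuousAt_totalSpace]
  refine ⟨continuousAt_id, ?_⟩
  have hp := FiberBundle.mem_baseSet_trivializationAt' (F := EuclideanSpace ℝ (Fin m))
    (E := (TangentSpace I : M → Type _)) p
  refine (continuousAt_const (y := w)).congr ?_
  filter_upwards [(trivializationAt (EuclideanSpace ℝ (Fin m)) (TangentSpace I)
    p).open_baseSet.mem_nhds hp] with y hy
  rw [Trivialization.symmL_apply, Trivialization.apply_mk_symm _ hy]
  exact hy

lemma continuousAt_inner_symmL_trivializationAt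
    [IsContinuousRiemannianBundle (EuclideanSpace ℝ (Fin m)) (fun x : M => TangentSpace I x)]
    (p : M) (v w : EuclideanSpace ℝ (Fin m)) :
    ContinuousAt (fun y : M =>
      (inner ℝ ((trivializationAt (EuclideanSpace ℝ (Fin m)) (TangentSpace I) p).symmL ℝ y v :
          TangentSpace I y)
        ((trivializationAt (EuclideanSpace ℝ (Fin m)) (TangentSpace I) p).symmL ℝ y w) : ℝ)) p :=
  ContinuousAt.inner_bundle (continuousAt_symmL_trivializationAt p v)
    (continuousAt_symmL_trivializationAt p w)

omit [RiemannianBundle (fun x : M => TangentSpace I x)] in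
lemma symmL_trivializationAt_self (p : M) (w : EuclideanSpace ℝ (Fin m)) :
    (trivializationAt (EuclideanSpace ℝ (Fin m)) (TangentSpace I) p).symmL ℝ p w =
      (w : TangentSpace I p) := by
  rw [TangentBundle.symmL_trivializationAt (mem_chart_source H p)]
  rw [mfderivWithin_range_extChartAt_symm]
  rfl

variable (I) in
/-- The differential of a real function at `x`, as a real-valued functional on `T_x M`. Compared
with `mfderiv`, the type of its values is `ℝ`, so that norms of values are absolute values. -/
noncomputable def covector (q : M → ℝ) (x : M) : TangentSpace I x →L[ℝ] ℝ :=
  mfderiv I 𝓘(ℝ, ℝ) q x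

omit [RiemannianBundle (fun x : M => TangentSpace I x)] in
/-- The pairing of the differential of a `C¹` function with the coordinate fields is continuous. -/
lemma continuousAt_covector_coordVector {q : M → ℝ} {p : M}
    (hq : ContMDiffAt I 𝓘(ℝ, ℝ) 1 q p) (j : Fin m) :
    ContinuousAt (fun y => covector I q y (coordVector I p y j)) p := by
  have h := (hq.mfderiv_const (m := 0) (by simp)).continuousAt
  have h2 := h.clm_apply (continuousAt_const (y := (EuclideanSpace.single j 1 :
    EuclideanSpace ℝ (Fin m))))
  refine h2.congr ?_
  filter_upwards [chart_source_mem_nhds H p] with y hy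
  have hid : (extChartAt 𝓘(ℝ, ℝ) (q p) : ℝ → ℝ) = id := by
    ext t
    simp [mfld_simps, chartAt_self_eq]
  rw [inTangentCoordinates_eq_mfderiv_comp (f := id) hy (by simp [chartAt_self_eq]), hid, mfderiv_id]
  simp only [coordVector, covector]
  rw [TangentBundle.symmL_trivializationAt hy]
  rfl

end

end C0Riemannian

/-! ### The topology of the distance, and Lipschitz functions from differentials -/

/-- A dense embedding of a locally compact space into a Hausdorff space is open: the image of a
compact neighbourhood is closed, so it contains an open set whose dense part it contains. -/
lemma Topology.IsEmbedding.isOpenEmbedding_of_denseRange {X Y : Type*} [TopologicalSpace X]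
    [TopologicalSpace Y] [LocallyCompactSpace X] [T2Space Y] {e : X → Y} (he : IsEmbedding e)
    (hd : DenseRange e) : IsOpenEmbedding e := by
  refine ⟨he, isOpen_iff_mem_nhds.2 ?_⟩
  rintro _ ⟨x, rfl⟩
  obtain ⟨K, hK, hxK⟩ := exists_compact_mem_nhds x
  rw [he.isInducing.nhds_eq_comap, Filter.mem_comap] at hxK
  obtain ⟨V, hV, hVK⟩ := hxK
  obtain ⟨O, hOV, hO, hxO⟩ := mem_nhds_iff.1 hV
  refine Filter.mem_of_superset (hO.mem_nhds hxO) ?_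
  calc O ⊆ closure (O ∩ Set.range e) := hd.open_subset_closure_inter hO
    _ ⊆ closure (e '' K) := by
      refine closure_mono ?_
      rintro _ ⟨hy, z, rfl⟩
      exact ⟨z, hVK (hOV hy), rfl⟩
    _ = e '' K := (hK.image he.continuous).isClosed.closure_eq
    _ ⊆ Set.range e := Set.image_subset_range _ _

namespace C0Riemannian

section

variable {m : ℕ} {H : Type*} [TopologicalSpace H]
  {I : ModelWithCorners ℝ (EuclideanSpace ℝ (Fin m)) H}
  {M : Type*} [TopologicalSpace M] [ChartedSpace H M] [IsManifold I ∞ M]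
  [RiemannianBundle (fun x : M => TangentSpace I x)]

variable [T2Space M]
  [IsContinuousRiemannianBundle (EuclideanSpace ℝ (Fin m)) (fun x : M => TangentSpace I x)]

omit [IsManifold I ∞ M] [RiemannianBundle (fun x : M => TangentSpace I x)] [T2Space M] in
variable (I M) in
include I in
lemma locallyCompactSpace_of_model : LocallyCompactSpace M := by
  have := I.locallyCompactSpace
  exact ChartedSpace.locallyCompactSpace H M

/-- The distance `d` induces the topology of `M`: both agree near each point with the topology of
the Riemannian distance. -/
lemma LocallyCompatible.isHomeomorph_toMetric {d : MetricSpace M} (hd : LocallyCompatible I d) :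
    IsHomeomorph (toMetric d) := by
  have := locallyCompactSpace_of_model I M
  have hnhds : ∀ p : M, Filter.map (toMetric d) (𝓝 p) = 𝓝 (toMetric d p) := by
    intro p
    obtain ⟨U, hpU, hU, hUd, hdist⟩ := hd p
    apply le_antisymm
    · refine Metric.nhds_basis_eball.ge_iff.2 fun ε hε => ?_
      filter_upwards [hU.mem_nhds hpU, eventually_riemannianEDist_lt I p hε] with y hy hlt
      change toMetric d y ∈ Metric.eball (toMetric d p) ε
      rw [Metric.mem_eball', hdist p hpU y hy]
      exact hlt
    · intro s hs
      obtain ⟨c, hc, hcs⟩ := setOfPred_riemannianEDist_lt_subset_nhds I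
        (Filter.mem_map.1 hs)
      filter_upwards [hUd.mem_nhds ⟨p, hpU, rfl⟩,
        Metric.eball_mem_nhds (toMetric d p) (ENNReal.coe_pos.2 hc)] with y hyU hy
      obtain ⟨z, hz, rfl⟩ := hyU
      rw [Metric.mem_eball', hdist p hpU z hz] at hy
      exact hcs hy
  refine ⟨continuous_iff_continuousAt.2 fun p => (hnhds p).le,
    IsOpenMap.of_nhds_le fun p => (hnhds p).ge, (toMetric d).bijective⟩

lemma LocallyCompatible.isOpenEmbedding_toCompletion {d : MetricSpace M}
    (hd : LocallyCompatible I d) : Topology.IsOpenEmbedding (toCompletion d) := by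
  have := locallyCompactSpace_of_model I M
  have h := hd.isHomeomorph_toMetric
  refine Topology.IsEmbedding.isOpenEmbedding_of_denseRange
    ((UniformSpace.Completion.coe_isometry (α := WithMetric M d)).isEmbedding.comp h.isEmbedding) ?_
  exact (UniformSpace.Completion.denseRange_coe (α := WithMetric M d)).comp
    h.surjective.denseRange UniformSpace.Completion.coe_isometry.continuous

omit [IsManifold I ∞ M] [T2Space M]
  [IsContinuousRiemannianBundle (EuclideanSpace ℝ (Fin m)) (fun x : M => TangentSpace I x)] in
lemma LocallyCompatible.eventually_edist_eq {d : MetricSpace M}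
    (hd : LocallyCompatible I d) (p : M) :
    ∃ U ∈ 𝓝 p, ∀ x ∈ U, ∀ y ∈ U,
      edist (toCompletion d x) (toCompletion d y) = Manifold.riemannianEDist I x y := by
  obtain ⟨U, hpU, hU, -, hdist⟩ := hd p
  refine ⟨U, hU.mem_nhds hpU, fun x hx y hy => ?_⟩
  rw [← hdist x hx y hy]
  exact UniformSpace.Completion.coe_isometry.edist_eq _ _

open Manifold in
/-- A `C¹` function whose differential has norm at most one near `p` is `1`-Lipschitz near `p` for
the Riemannian distance, because short curves between points near `p` stay near `p`. -/
lemma exists_nhds_edist_le_riemannianEDist {F : M → ℝ} {p : M}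
    (hF : ∀ᶠ y in 𝓝 p, ContMDiffAt I 𝓘(ℝ, ℝ) 1 F y)
    (hF' : ∀ᶠ y in 𝓝 p, ∀ v : TangentSpace I y,
      ‖covector I F y v‖ ≤ ‖v‖) :
    ∃ U ∈ 𝓝 p, ∀ x ∈ U, ∀ y ∈ U, edist (F x) (F y) ≤ riemannianEDist I x y := by
  have := locallyCompactSpace_of_model I M
  obtain ⟨c, hc, hcs⟩ := setOfPred_riemannianEDist_lt_subset_nhds I (hF.and hF')
  -- Points within `c / 4` of `p` are less than `c / 2` apart, so a nearly shortest curve between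
  -- them stays within `3 c / 4` of `p`.
  have hc' : (0 : ℝ≥0∞) < (c / 4 : ℝ≥0) := by
    rw [ENNReal.coe_pos]
    positivity
  refine ⟨_, eventually_riemannianEDist_lt I p hc', fun x hx y hy => ?_⟩
  have hxy : riemannianEDist I x y < (c / 2 : ℝ≥0) := by
    calc riemannianEDist I x y ≤ riemannianEDist I x p + riemannianEDist I p y :=
          riemannianEDist_triangle
      _ < (c / 4 : ℝ≥0) + (c / 4 : ℝ≥0) :=
          ENNReal.add_lt_add (by rw [riemannianEDist_comm]; exact hx) hy
      _ = (c / 2 : ℝ≥0) := by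
          rw [← ENNReal.coe_add]
          congr 1
          ring
  refine le_of_forall_gt fun r hr => ?_
  obtain ⟨γ, hγ0, hγ1, hγ, hlen, -⟩ :=
    exists_lt_locally_constant_of_riemannianEDist_lt (lt_min hr hxy) zero_lt_one
  have hmem : ∀ t ∈ Set.Icc (0 : ℝ) 1, riemannianEDist I p (γ t) < c := by
    intro t ht
    calc riemannianEDist I p (γ t) ≤ riemannianEDist I p x + riemannianEDist I x (γ t) :=
          riemannianEDist_triangle
      _ ≤ riemannianEDist I p x + pathELength I γ 0 t := by
          gcongr
          exact riemannianEDist_le_pathELength (I := I) (γ := γ) hγ.contMDiffOn hγ0 rfl ht.1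
      _ ≤ riemannianEDist I p x + pathELength I γ 0 1 := by
          gcongr
          exact ht.2
      _ < (c / 4 : ℝ≥0) + (c / 2 : ℝ≥0) :=
          ENNReal.add_lt_add hx (hlen.trans_le (min_le_right _ _))
      _ ≤ c := by
          rw [← ENNReal.coe_add, ENNReal.coe_le_coe, ← NNReal.coe_le_coe]
          push_cast
          linarith [c.coe_nonneg]
  have hsmooth : ContDiffOn ℝ 1 (F ∘ γ) (Set.Icc 0 1) := by
    rw [← contMDiffOn_iff_contDiffOn]
    intro t ht
    exact ContMDiffAt.comp_contMDiffWithinAt t (hcs (hmem t ht)).1 hγ.contMDiffAt.contMDiffWithinAt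
  calc edist (F x) (F y) = ‖(F ∘ γ) 1 - (F ∘ γ) 0‖ₑ := by
        rw [edist_comm, edist_eq_enorm_sub]
        simp [hγ0, hγ1]
    _ ≤ ∫⁻ t in Set.Icc (0 : ℝ) 1, ‖derivWithin (F ∘ γ) (Set.Icc 0 1) t‖ₑ :=
        enorm_sub_le_lintegral_derivWithin_Icc_of_contDiffOn_Icc hsmooth zero_le_one
    _ ≤ ∫⁻ t in Set.Icc (0 : ℝ) 1, ‖mfderivWithin 𝓘(ℝ, ℝ) I γ (Set.Icc 0 1) t 1‖ₑ := by
        refine setLIntegral_mono' measurableSet_Icc fun t ht => ?_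
        have hcomp : mfderivWithin 𝓘(ℝ, ℝ) 𝓘(ℝ, ℝ) (F ∘ γ) (Set.Icc 0 1) t =
            (mfderiv I 𝓘(ℝ, ℝ) F (γ t)).comp (mfderivWithin 𝓘(ℝ, ℝ) I γ (Set.Icc 0 1) t) := by
          apply mfderiv_comp_mfderivWithin
          · exact (hcs (hmem t ht)).1.mdifferentiableAt one_ne_zero
          · exact (hγ.mdifferentiable one_ne_zero).mdifferentiableOn _ ht
          · rw [uniqueMDiffWithinAt_iff_uniqueDiffWithinAt]
            exact uniqueDiffOn_Icc zero_lt_one _ ht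
        have h1 : derivWithin (F ∘ γ) (Set.Icc 0 1) t =
            covector I F (γ t) (mfderivWithin 𝓘(ℝ, ℝ) I γ (Set.Icc 0 1) t 1) := by
          rw [← fderivWithin_derivWithin, ← mfderivWithin_eq_fderivWithin, hcomp]
          rfl
        rw [h1]
        have h2 := (hcs (hmem t ht)).2 (mfderivWithin 𝓘(ℝ, ℝ) I γ (Set.Icc 0 1) t 1)
        exact enorm_le_iff_norm_le.2 h2
    _ = pathELength I γ 0 1 := (pathELength_eq_lintegral_mfderivWithin_Icc (I := I)).symm
    _ < r := hlen.trans_le (min_le_left _ _)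

end

end C0Riemannian

/-! ### Differentials of Lipschitz functions -/

namespace C0Riemannian

section

variable {m : ℕ} {H : Type*} [TopologicalSpace H]
  {I : ModelWithCorners ℝ (EuclideanSpace ℝ (Fin m)) H}
  {M : Type*} [TopologicalSpace M] [ChartedSpace H M] [IsManifold I ∞ M]
  [RiemannianBundle (fun x : M => TangentSpace I x)]

omit [IsManifold I ∞ M] [RiemannianBundle (fun x : M => TangentSpace I x)] in
lemma covector_eq_zero_of_not_mdifferentiableAt {q : M → ℝ} {x : M}
    (h : ¬ MDifferentiableAt I 𝓘(ℝ, ℝ) q x) : covector I q x = 0 :=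
  mfderiv_zero_of_not_mdifferentiableAt h

variable
  [IsContinuousRiemannianBundle (EuclideanSpace ℝ (Fin m)) (fun x : M => TangentSpace I x)]

open Manifold in
/-- At an interior point, the differential of a function that is `K`-Lipschitz for the Riemannian
distance has norm at most `K`: follow coordinate lines through the point. At boundary points this
can fail, since only the tangent vectors pointing into `M` are velocities of curves. -/
lemma norm_covector_le_of_isInteriorPoint {q : M → ℝ} {x : M} (hx : I.IsInteriorPoint x)
    {K : ℝ≥0} (h : ∀ᶠ y in 𝓝 x, edist (q x) (q y) ≤ K * riemannianEDist I x y) :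
    ‖covector I q x‖ ≤ K := by
  refine ContinuousLinearMap.opNorm_le_bound _ K.coe_nonneg fun v => ?_
  by_cases hq : MDifferentiableAt I 𝓘(ℝ, ℝ) q x
  swap
  · have h0 : covector I q x v = 0 := by
      rw [covector_eq_zero_of_not_mdifferentiableAt hq]
      rfl
    rw [h0, norm_zero]
    exact mul_nonneg K.coe_nonneg (norm_nonneg v)
  refine le_of_forall_pos_le_add fun ε' hε' => ?_
  obtain ⟨ε, hε, hεK⟩ : ∃ ε : ℝ, 0 < ε ∧ K * (‖v‖ + ε) ≤ K * ‖v‖ + ε' := by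
    refine ⟨ε' / (K + 1), by positivity, ?_⟩
    have : K * (ε' / (K + 1)) ≤ ε' := by
      rw [mul_div_assoc', div_le_iff₀ (by positivity)]
      nlinarith [K.coe_nonneg]
    linarith
  refine le_trans ?_ hεK
  let w : EuclideanSpace ℝ (Fin m) := v
  set η : ℝ → EuclideanSpace ℝ (Fin m) := fun t => extChartAt I x x + t • w with hη
  set γ : ℝ → M := fun t => (extChartAt I x).symm (η t) with hγ
  set O := interior (extChartAt I x).target
  have hη0 : η 0 = extChartAt I x x := by simp [hη]
  have hγ0 : γ 0 = x := by simp [hγ, hη0]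
  have hηc : Continuous η := by fun_prop
  have hηd : ∀ t, HasDerivAt η w t := fun t => by
    simpa only [one_smul, id] using ((hasDerivAt_id t).smul_const w).const_add (extChartAt I x x)
  have hO : ∀ᶠ t in 𝓝 (0 : ℝ), η t ∈ O := by
    refine hηc.continuousAt.eventually (isOpen_interior.mem_nhds ?_)
    rw [hη0]
    exact ModelWithCorners.isInteriorPoint_iff.1 hx
  have hsymm : ∀ t, η t ∈ O → MDifferentiableAt 𝓘(ℝ, EuclideanSpace ℝ (Fin m)) I
      (extChartAt I x).symm (η t) := fun t ht =>
    ((contMDiffOn_extChartAt_symm (n := 1) x).contMDiffAt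
      (mem_interior_iff_mem_nhds.1 ht)).mdifferentiableAt one_ne_zero
  have hηm : ∀ t, HasMFDerivAt 𝓘(ℝ, ℝ) 𝓘(ℝ, EuclideanSpace ℝ (Fin m)) η t
      (ContinuousLinearMap.toSpanSingleton ℝ w) := fun t => (hηd t).hasFDerivAt.hasMFDerivAt
  have hvel : ∀ t, η t ∈ O → HasMFDerivAt 𝓘(ℝ, ℝ) I γ t
      (((trivializationAt (EuclideanSpace ℝ (Fin m)) (TangentSpace I) x).symmL ℝ (γ t)).comp
        (ContinuousLinearMap.toSpanSingleton ℝ w)) := by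
    intro t ht
    have htgt : η t ∈ (extChartAt I x).target := interior_subset ht
    have h1 := (hsymm t ht).hasMFDerivAt.comp t (hηm t)
    have h2 : mfderiv 𝓘(ℝ, EuclideanSpace ℝ (Fin m)) I (extChartAt I x).symm (η t) =
        (trivializationAt (EuclideanSpace ℝ (Fin m)) (TangentSpace I) x).symmL ℝ (γ t) := by
      have hsrc : γ t ∈ (chartAt H x).source := by
        rw [← extChartAt_source I]
        exact (extChartAt I x).map_target htgt
      rw [TangentBundle.symmL_trivializationAt hsrc]
      have h3 : extChartAt I x (γ t) = η t := (extChartAt I x).right_inv htgt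
      rw [h3, mfderivWithin_of_mem_nhds]
      exact Filter.mem_of_superset (mem_interior_iff_mem_nhds.1 ht)
        (extChartAt_target_subset_range x)
    rw [← h2]
    exact h1
  have hγc : ContinuousAt γ 0 := (hvel 0 hO.self_of_nhds).continuousAt
  have hnorm : ∀ᶠ t in 𝓝 (0 : ℝ), ‖((trivializationAt (EuclideanSpace ℝ (Fin m))
      (TangentSpace I) x).symmL ℝ (γ t) w : TangentSpace I (γ t))‖ < ‖v‖ + ε := by
    have hc := (continuousAt_inner_symmL_trivializationAt (I := I) x w w).sqrt
    have hval : √(inner ℝ ((trivializationAt (EuclideanSpace ℝ (Fin m)) (TangentSpace I) x).symmL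
        ℝ x w : TangentSpace I x) ((trivializationAt (EuclideanSpace ℝ (Fin m))
          (TangentSpace I) x).symmL ℝ x w)) < ‖v‖ + ε := by
      rw [symmL_trivializationAt_self, ← norm_eq_sqrt_real_inner]
      exact lt_add_of_pos_right _ hε
    have hev := hc.eventually (gt_mem_nhds hval)
    rw [← hγ0] at hev
    filter_upwards [hγc.eventually hev] with t ht
    rw [norm_eq_sqrt_real_inner]
    rwa [hγ0] at ht
  rw [← hγ0] at h
  obtain ⟨δ, hδ, hball⟩ := Metric.eventually_nhds_iff_ball.1
    ((hO.and hnorm).and (hγc.eventually h))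
  -- The coordinate line has speed less than `‖v‖ + ε` up to time `δ`, which bounds the distance
  -- travelled and hence the difference quotients of `q` along it.
  have hbound : ∀ t ∈ Set.Ioo (0 : ℝ) δ, ‖t⁻¹ • (q (γ (0 + t)) - q (γ 0))‖ ≤ K * (‖v‖ + ε) := by
    intro t ht
    have hin : ∀ s ∈ Set.Icc 0 t, s ∈ Metric.ball (0 : ℝ) δ := fun s hs => by
      rw [Metric.mem_ball, Real.dist_eq, sub_zero, abs_of_nonneg hs.1]
      exact hs.2.trans_lt ht.2
    have hlen : riemannianEDist I (γ 0) (γ t) ≤ ENNReal.ofReal (t * (‖v‖ + ε)) := by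
      calc riemannianEDist I (γ 0) (γ t) ≤ pathELength I γ 0 t := by
            refine riemannianEDist_le_pathELength ?_ rfl rfl ht.1.le
            refine (contMDiffOn_extChartAt_symm x).comp (t := (extChartAt I x).target) ?_ ?_
            · rw [contMDiffOn_iff_contDiffOn]
              exact (contDiff_const.add (contDiff_id.smul contDiff_const)).contDiffOn
            · exact fun s hs => interior_subset (s := (extChartAt I x).target) (hball s (hin s hs)).1.1
        _ = ∫⁻ s in Set.Icc 0 t, ‖mfderiv 𝓘(ℝ, ℝ) I γ s 1‖ₑ :=
            pathELength_eq_lintegral_mfderiv_Icc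
        _ ≤ ∫⁻ s in Set.Icc 0 t, ENNReal.ofReal (‖v‖ + ε) := by
            refine setLIntegral_mono' measurableSet_Icc fun s hs => ?_
            have hs1 : mfderiv 𝓘(ℝ, ℝ) I γ s (1 : ℝ) = (trivializationAt
                (EuclideanSpace ℝ (Fin m)) (TangentSpace I) x).symmL ℝ (γ s) w := by
              rw [(hvel s (hball s (hin s hs)).1.1).mfderiv]
              exact congrArg _ (one_smul ℝ w)
            refine (congrArg enorm hs1).trans_le ?_
            rw [← ofReal_norm]
            exact ENNReal.ofReal_le_ofReal (hball s (hin s hs)).1.2.le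
        _ = ENNReal.ofReal (t * (‖v‖ + ε)) := by
            rw [setLIntegral_const, Real.volume_Icc, sub_zero, mul_comm,
              ENNReal.ofReal_mul ht.1.le]
    have hqt : ENNReal.ofReal (dist (q (γ 0)) (q (γ t))) ≤
        ENNReal.ofReal (K * (t * (‖v‖ + ε))) := by
      rw [← edist_dist, ENNReal.ofReal_mul K.coe_nonneg, ENNReal.ofReal_coe_nnreal]
      exact (hball t (hin t ⟨ht.1.le, le_rfl⟩)).2.trans (by gcongr)
    rw [ENNReal.ofReal_le_ofReal_iff (mul_nonneg K.coe_nonneg (mul_nonneg ht.1.le (by positivity))),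
      dist_comm, dist_eq_norm] at hqt
    rw [zero_add, norm_smul, norm_inv, Real.norm_of_nonneg ht.1.le, inv_mul_le_iff₀ ht.1]
    linarith
  have hderiv : HasDerivAt (q ∘ γ) (covector I q x v) 0 := by
    have hq' : HasMFDerivAt I 𝓘(ℝ, ℝ) q (γ 0) (mfderiv I 𝓘(ℝ, ℝ) q (γ 0)) := by
      rw [hγ0]
      exact hq.hasMFDerivAt
    have h1 : HasFDerivAt (q ∘ γ) ((covector I q (γ 0)).comp (((trivializationAt
        (EuclideanSpace ℝ (Fin m)) (TangentSpace I) x).symmL ℝ (γ 0)).comp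
          (ContinuousLinearMap.toSpanSingleton ℝ w)) : ℝ →L[ℝ] ℝ) 0 :=
      hasMFDerivAt_iff_hasFDerivAt.1 (hq'.comp 0 (hvel 0 hO.self_of_nhds))
    have h2 : ∀ z, z = x → covector I q z ((trivializationAt (EuclideanSpace ℝ (Fin m))
        (TangentSpace I) x).symmL ℝ z w) = covector I q x v := by
      rintro _ rfl
      rw [symmL_trivializationAt_self]
    have h3 := h1.hasDerivAt
    rw [ContinuousLinearMap.comp_apply, ContinuousLinearMap.comp_apply,
      ContinuousLinearMap.toSpanSingleton_apply, one_smul, h2 _ hγ0] at h3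
    exact h3
  have hlim := hderiv.tendsto_slope_zero_right.norm
  refine le_of_tendsto hlim ?_
  filter_upwards [Ioo_mem_nhdsGT hδ] with t ht using hbound t ht

end

end C0Riemannian

/-! ### The coefficient of a product of differentials -/

namespace C0Riemannian

section

variable {m : ℕ} {H : Type*} [TopologicalSpace H]
  {I : ModelWithCorners ℝ (EuclideanSpace ℝ (Fin m)) H}
  {M : Type*} [TopologicalSpace M] [ChartedSpace H M] [IsManifold I ∞ M]
  [RiemannianBundle (fun x : M => TangentSpace I x)]

variable (I) in
/-- The coordinate vectors of the chart at `x` as a basis of `T_x M`. -/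
noncomputable def stdTangentBasis (x : M) : Module.Basis (Fin m) ℝ (TangentSpace I x) :=
  (EuclideanSpace.basisFun (Fin m) ℝ).toBasis

/-- The coefficient of `dq₁ ∧ … ∧ dqₘ` is the oriented volume of the gradients. -/
lemma formCoeff_eq_volumeForm (o : ManifoldOrientation I M) (q : Fin m → M → ℝ) (x : M) :
    formCoeff I o q x = (o.at' x).volumeForm fun i =>
      letI := FiniteDimensional.complete ℝ (TangentSpace I x)
      (InnerProductSpace.toDual ℝ (TangentSpace I x)).symm (covector I (q i) x) := by
  have := FiniteDimensional.complete ℝ (TangentSpace I x)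
  rw [← (o.at' x).det_div_volumeForm_eq (fun i => covector I (q i) x) (stdTangentBasis I x)]
  have h : (stdTangentBasis I x : Fin m → TangentSpace I x) = stdVector I x := by
    ext1 j
    exact (EuclideanSpace.basisFun (Fin m) ℝ).coe_toBasis ▸ EuclideanSpace.basisFun_apply _ _ j
  rw [h]
  rfl

/-- Hadamard's inequality. -/
lemma abs_formCoeff_le (o : ManifoldOrientation I M) (q : Fin m → M → ℝ) (x : M) :
    |formCoeff I o q x| ≤ ∏ i, ‖covector I (q i) x‖ := by
  rw [formCoeff_eq_volumeForm]
  refine ((o.at' x).abs_volumeForm_apply_le _).trans_eq ?_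
  refine Finset.prod_congr rfl fun i _ => ?_
  have := FiniteDimensional.complete ℝ (TangentSpace I x)
  exact LinearIsometryEquiv.norm_map _ _

/-- The coordinate fields of the chart at `p`, as a basis of the tangent space at a nearby point. -/
noncomputable def coordBasis (p x : M)
    (hx : x ∈ (trivializationAt (EuclideanSpace ℝ (Fin m)) (TangentSpace I) p).baseSet) :
    Module.Basis (Fin m) ℝ (TangentSpace I x) :=
  (EuclideanSpace.basisFun (Fin m) ℝ).toBasis.map
    ((trivializationAt (EuclideanSpace ℝ (Fin m)) (TangentSpace I) p).continuousLinearEquivAt ℝ x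
      hx).toLinearEquiv.symm

/-- In coordinates the coefficient is `det (∂ⱼ qᵢ)` divided by `σ √(det gᵢⱼ)`, where the sign `σ` is
constant near `p` because the orientation is. -/
lemma continuousAt_formCoeff
    [IsContinuousRiemannianBundle (EuclideanSpace ℝ (Fin m)) (fun x : M => TangentSpace I x)]
    (o : ManifoldOrientation I M) {q : Fin m → M → ℝ} {p : M}
    (hq : ∀ i, ContMDiffAt I 𝓘(ℝ, ℝ) 1 (q i) p) : ContinuousAt (formCoeff I o q) p := by
  classical
  obtain ⟨o₀, ho₀⟩ := o.locally_constant p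
  set σ : ℝ := if o₀ = (EuclideanSpace.basisFun (Fin m) ℝ).toBasis.orientation then 1 else -1
    with hσ
  set G : M → ℝ := fun x => (Matrix.of fun i j : Fin m =>
    (inner ℝ (coordVector I p x i) (coordVector I p x j) : ℝ)).det
  have hvec : ∀ (x : M) (hx : x ∈ (trivializationAt (EuclideanSpace ℝ (Fin m))
      (TangentSpace I) p).baseSet) (j : Fin m), coordBasis p x hx j = coordVector I p x j := by
    intro x hx j
    rw [coordBasis, Module.Basis.map_apply, OrthonormalBasis.coe_toBasis,
      EuclideanSpace.basisFun_apply, coordVector]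
    exact congrFun (Trivialization.symm_continuousLinearEquivAt_eq _ hx) _
  have hvol : ∀ᶠ x in 𝓝 p, (o.at' x).volumeForm (coordVector I p x) = σ * √(G x) ∧
      formCoeff I o q x = (Matrix.of fun i j => covector I (q i) x (coordVector I p x j)).det /
        (σ * √(G x)) ∧ σ * √(G x) ≠ 0 := by
    filter_upwards [ho₀] with x ⟨hx, hxo⟩
    have := FiniteDimensional.complete ℝ (TangentSpace I x)
    have h1 := (o.at' x).volumeForm_eq_sign_mul_sqrt ((trivializationAt (EuclideanSpace ℝ (Fin m))
      (TangentSpace I) p).continuousLinearEquivAt ℝ x hx).toLinearEquiv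
      (EuclideanSpace.basisFun (Fin m) ℝ).toBasis
    have h2 : (coordBasis p x hx : Fin m → TangentSpace I x) = coordVector I p x :=
      funext (hvec x hx)
    have h3 : (o.at' x).volumeForm (coordVector I p x) = σ * √(G x) := by
      have h4 : ∀ j, ((trivializationAt (EuclideanSpace ℝ (Fin m)) (TangentSpace I)
          p).continuousLinearEquivAt ℝ x hx).toLinearEquiv.symm
            ((EuclideanSpace.basisFun (Fin m) ℝ).toBasis j) = coordVector I p x j := fun j =>
        hvec x hx j
      simp only [h4] at h1
      rw [hσ, ← hxo]
      exact h1
    refine ⟨h3, ?_, ?_⟩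
    · rw [formCoeff_eq_volumeForm, ← h3, ← h2]
      exact ((o.at' x).det_div_volumeForm_eq (fun i => covector I (q i) x) (coordBasis p x hx)).symm
    · rw [← h3, ← h2]
      exact (o.at' x).volumeForm_basis_ne_zero _
  have hG : ContinuousAt G p := by
    refine ContinuousAt.comp (g := Matrix.det) (Continuous.matrix_det continuous_id).continuousAt ?_
    refine continuousAt_pi.2 fun i => continuousAt_pi.2 fun j => ?_
    exact continuousAt_inner_symmL_trivializationAt p _ _
  have hA : ContinuousAt (fun x =>
      (Matrix.of fun i j => covector I (q i) x (coordVector I p x j)).det) p := by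
    refine ContinuousAt.comp (g := Matrix.det) (Continuous.matrix_det continuous_id).continuousAt ?_
    refine continuousAt_pi.2 fun i => continuousAt_pi.2 fun j => ?_
    exact continuousAt_covector_coordVector (hq i) j
  exact (hA.div (continuousAt_const.mul hG.sqrt) hvol.self_of_nhds.2.2).congr
    (hvol.mono fun x hx => hx.2.1.symm)

end

end C0Riemannian

/-! ### Local and global lower bounds for mass measures -/

namespace C0Riemannian

section

variable {m : ℕ} {H : Type*} [TopologicalSpace H]
  {I : ModelWithCorners ℝ (EuclideanSpace ℝ (Fin m)) H}
  {M : Type*} [TopologicalSpace M] [ChartedSpace H M] [IsManifold I ∞ M]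
  [RiemannianBundle (fun x : M => TangentSpace I x)]

variable [T2Space M]
  [IsContinuousRiemannianBundle (EuclideanSpace ℝ (Fin m)) (fun x : M => TangentSpace I x)]

/-- In the chart at `p`, a linear functional of norm less than one on `T_p M` is the germ at `p` of
a `1`-Lipschitz function on the completion. -/
lemma exists_lip_eq_chart {d : MetricSpace M} (hd : LocallyCompatible I d) (p : M)
    (α : TangentSpace I p →L[ℝ] ℝ) (hα : ‖α‖ < 1) :
    ∃ ρ : Lip (UniformSpace.Completion (WithMetric M d)),
      LipschitzWith 1 (ρ : UniformSpace.Completion (WithMetric M d) → ℝ) ∧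
      ContMDiffAt I 𝓘(ℝ, ℝ) 1 (ρ.1 ∘ toCompletion d) p ∧
      covector I (ρ.1 ∘ toCompletion d) p = α := by
  have : Nonempty M := ⟨p⟩
  let α' : EuclideanSpace ℝ (Fin m) →L[ℝ] ℝ := α
  set F : M → ℝ := fun y => α' (extChartAt I p y) with hFdef
  have hsmooth : ∀ y ∈ (chartAt H p).source, ContMDiffAt I 𝓘(ℝ, ℝ) 1 F y := fun y hy =>
    α'.contMDiff.contMDiffAt.comp y (contMDiffAt_extChartAt' hy)
  have hcov : ∀ y ∈ (chartAt H p).source, ∀ v : TangentSpace I y, covector I F y v =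
      α (((trivializationAt (EuclideanSpace ℝ (Fin m)) (TangentSpace I) p).symmL ℝ p).comp
        ((trivializationAt (EuclideanSpace ℝ (Fin m)) (TangentSpace I) p).continuousLinearMapAt ℝ y)
          v) := by
    intro y hy v
    have h1 : HasMFDerivAt I 𝓘(ℝ, ℝ) F y (α'.comp (mfderiv I
        𝓘(ℝ, EuclideanSpace ℝ (Fin m)) (extChartAt I p) y)) :=
      (α'.hasMFDerivAt).comp y (mdifferentiableAt_extChartAt hy).hasMFDerivAt
    rw [covector, h1.mfderiv, ← TangentBundle.continuousLinearMapAt_trivializationAt hy]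
    exact (congrArg α (symmL_trivializationAt_self p _)).symm
  have hnorm : ∀ᶠ y in 𝓝 p, ∀ v : TangentSpace I y, ‖covector I F y v‖ ≤ ‖v‖ := by
    -- This distortion factor is more than one, while its product with `‖α‖` is at most one.
    have hr : 1 < 2 / (1 + ‖α‖) := by
      rw [lt_div_iff₀ (by positivity)]
      linarith
    filter_upwards [chart_source_mem_nhds H p,
      eventually_norm_symmL_trivializationAt_self_comp_lt (EuclideanSpace ℝ (Fin m))
        (TangentSpace I : M → Type _) p hr] with y hy hlt v
    rw [hcov y hy]
    refine (α.le_opNorm _).trans ?_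
    have h1 := (((trivializationAt (EuclideanSpace ℝ (Fin m)) (TangentSpace I) p).symmL ℝ p).comp
        ((trivializationAt (EuclideanSpace ℝ (Fin m)) (TangentSpace I) p).continuousLinearMapAt ℝ y)
          ).le_of_opNorm_le hlt.le v
    calc ‖α‖ * _ ≤ ‖α‖ * (2 / (1 + ‖α‖) * ‖v‖) := by gcongr
      _ = (2 * ‖α‖ / (1 + ‖α‖)) * ‖v‖ := by ring
      _ ≤ 1 * ‖v‖ := by
        gcongr
        rw [div_le_one (by positivity)]
        linarith
      _ = ‖v‖ := one_mul _
  obtain ⟨U, hU, hUlip⟩ := exists_nhds_edist_le_riemannianEDist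
    (Filter.mem_of_superset (chart_source_mem_nhds H p) hsmooth) hnorm
  obtain ⟨V, hV, hVd⟩ := hd.eventually_edist_eq p
  have hemb := hd.isOpenEmbedding_toCompletion
  have hlip : LipschitzOnWith 1 (F ∘ Function.invFun (toCompletion d))
      (toCompletion d '' (U ∩ V)) := by
    rintro _ ⟨x, hx, rfl⟩ _ ⟨y, hy, rfl⟩
    have := Function.leftInverse_invFun hemb.injective
    rw [Function.comp_apply, Function.comp_apply, this x, this y, ENNReal.coe_one, one_mul,
      hVd x hx.2 y hy.2]
    exact hUlip x hx.1 y hy.1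
  obtain ⟨g, hg, hgF⟩ := hlip.extend_real
  have heq : g ∘ toCompletion d =ᶠ[𝓝 p] F := by
    filter_upwards [Filter.inter_mem hU hV] with y hy
    have := hgF ⟨y, hy, rfl⟩
    rw [Function.comp_apply, ← this, Function.comp_apply,
      Function.leftInverse_invFun hemb.injective y]
  refine ⟨⟨g, 1, hg⟩, hg, (hsmooth p (mem_chart_source H p)).congr_of_eventuallyEq heq, ?_⟩
  have h1 : covector I (g ∘ toCompletion d) p = covector I F p := heq.mfderiv_eq
  refine h1.trans (ContinuousLinearMap.ext fun v => ?_)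
  rw [hcov p (mem_chart_source H p)]
  congr 1
  rw [ContinuousLinearMap.comp_apply]
  exact (trivializationAt (EuclideanSpace ℝ (Fin m)) (TangentSpace I) p).symmL_continuousLinearMapAt
    (FiberBundle.mem_baseSet_trivializationAt' p) v

/-- The measure-theoretic core of the lower bounds. If `T` is integration over `M` and
`|T (f, q)| ≤ ∫ |f| dμ` for all `f`, then near a point where `dq₁ ∧ … ∧ dqₘ` is continuous and has
size more than `c`, the form keeps its sign, so `μ` dominates `c` times the volume there. -/
lemma exists_nhds_volume_le_of_lt_formCoeff [MeasurableSpace M] [BorelSpace M]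
    {o : ManifoldOrientation I M} {d : MetricSpace M} (hd : LocallyCompatible I d)
    {T : Functional (UniformSpace.Completion (WithMetric M d)) m} (hT : IsCanonicalCurrent I o d T)
    {μ : Measure (UniformSpace.Completion (WithMetric M d))} [IsFiniteMeasure μ]
    (q : Fin m → Lip (UniformSpace.Completion (WithMetric M d)))
    (hμ : ∀ f, |T f q| ≤ ∫ x, |f.1 x| ∂μ) {p : M}
    (hq : ∀ i, ContMDiffAt I 𝓘(ℝ, ℝ) 1 ((q i).1 ∘ toCompletion d) p) {c : ℝ} (hc0 : 0 ≤ c)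
    (hc : c < |formCoeff I o (fun i => (q i).1 ∘ toCompletion d) p|) :
    ∃ W : Set (UniformSpace.Completion (WithMetric M d)), IsOpen W ∧ toCompletion d p ∈ W ∧
      ∀ s ⊆ W, ENNReal.ofReal c * (riemannianVolume I M).map (toCompletion d) s ≤ μ s := by
  have hemb := hd.isOpenEmbedding_toCompletion
  set h := formCoeff I o (fun i => (q i).1 ∘ toCompletion d) with hh
  have hcont : ContinuousAt h p := continuousAt_formCoeff o hq
  obtain ⟨σ, hσ, hσc⟩ : ∃ σ : ℝ, |σ| = 1 ∧ c < σ * h p := by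
    rcases abs_choice (h p) with h1 | h1
    · exact ⟨1, by simp, by rw [one_mul, ← h1]; exact hc⟩
    · exact ⟨-1, by simp, by rw [neg_one_mul, ← h1]; exact hc⟩
  have hev : ∀ᶠ y in 𝓝 p, c < σ * h y :=
    (continuousAt_const.mul hcont).eventually (lt_mem_nhds hσc)
  obtain ⟨U, hU, hUo, hpU⟩ := mem_nhds_iff.1 hev
  refine ⟨toCompletion d '' U, hemb.isOpenMap U hUo, ⟨p, hpU, rfl⟩, fun s hs => ?_⟩
  rw [← smul_eq_mul, ← Measure.smul_apply]
  refine measure_le_of_forall_lipschitz (hemb.isOpenMap U hUo) (fun f hf0 hfW => ?_) hs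
  obtain ⟨K, hK⟩ := f.2.1
  obtain ⟨C, hC⟩ := f.2.2
  have hfU : ∀ y, f.1 (toCompletion d y) ≠ 0 → y ∈ U := fun y hy => by
    obtain ⟨z, hz, hzy⟩ := hfW _ hy
    rwa [← hemb.injective hzy]
  have hle : ∀ y, c * f.1 (toCompletion d y) ≤ σ * (f.1 (toCompletion d y) * h y) := by
    intro y
    by_cases hy : f.1 (toCompletion d y) = 0
    · rw [hy, zero_mul, mul_zero, mul_zero]
    · have := (show c < σ * h y from hU (hfU y hy)).le
      nlinarith [mul_le_mul_of_nonneg_right this (hf0 (toCompletion d y))]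
  have hint := hT f q
  have hfμ : Integrable f.1 μ := by
    refine Integrable.of_bound hK.continuous.aestronglyMeasurable C (ae_of_all _ fun x => ?_)
    exact hC x
  calc ∫⁻ x, ENNReal.ofReal (f.1 x) ∂(ENNReal.ofReal c •
        (riemannianVolume I M).map (toCompletion d))
      = ENNReal.ofReal c * ∫⁻ y, ENNReal.ofReal (f.1 (toCompletion d y)) ∂riemannianVolume I M := by
        rw [lintegral_smul_measure, hemb.measurableEmbedding.lintegral_map, smul_eq_mul]
    _ = ∫⁻ y, ENNReal.ofReal (c * f.1 (toCompletion d y)) ∂riemannianVolume I M := by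
        rw [← lintegral_const_mul' _ _ ENNReal.ofReal_ne_top]
        simp_rw [ENNReal.ofReal_mul hc0]
    _ ≤ ∫⁻ y, ENNReal.ofReal (σ * (f.1 (toCompletion d y) * h y)) ∂riemannianVolume I M :=
        lintegral_mono fun y => ENNReal.ofReal_le_ofReal (hle y)
    _ = ENNReal.ofReal (σ * T f q) := by
        rw [hint.2, ← integral_const_mul, ofReal_integral_eq_lintegral_ofReal
          (hint.1.const_mul σ)]
        exact ae_of_all _ fun y => (mul_nonneg hc0 (hf0 _)).trans (hle y)
    _ ≤ ENNReal.ofReal (∫ x, |f.1 x| ∂μ) := by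
        refine ENNReal.ofReal_le_ofReal (le_trans ?_ (hμ f))
        refine (le_abs_self _).trans_eq ?_
        rw [abs_mul, hσ, one_mul]
    _ = ∫⁻ x, ENNReal.ofReal (f.1 x) ∂μ := by
        simp_rw [abs_of_nonneg (hf0 _)]
        exact ofReal_integral_eq_lintegral_ofReal hfμ (ae_of_all _ hf0)

/-- Local lower bounds with every constant below `C` add up to a global one with the constant `C`,
by Lindelöf's covering theorem. -/
lemma ofReal_smul_volume_le_of_forall_exists_nhds [SecondCountableTopology M] [MeasurableSpace M]
    [BorelSpace M] {d : MetricSpace M} (hd : LocallyCompatible I d)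
    {μ : Measure (UniformSpace.Completion (WithMetric M d))} {Z : Set M}
    (hZ : riemannianVolume I M Z = 0) {C : ℝ} (hC : 0 < C)
    (h : ∀ c, 0 ≤ c → c < C → ∀ p ∉ Z, ∃ W : Set (UniformSpace.Completion (WithMetric M d)),
      IsOpen W ∧ toCompletion d p ∈ W ∧
      ∀ s ⊆ W, ENNReal.ofReal c * (riemannianVolume I M).map (toCompletion d) s ≤ μ s) :
    ENNReal.ofReal C • (riemannianVolume I M).map (toCompletion d) ≤ μ := by
  have hemb := hd.isOpenEmbedding_toCompletion
  have hstep : ∀ c, 0 ≤ c → c < C →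
      ENNReal.ofReal c • (riemannianVolume I M).map (toCompletion d) ≤ μ := by
    intro c hc0 hcC
    choose! W hWo hpW hW using h c hc0 hcC
    obtain ⟨t, htZ, htc, hcov⟩ := TopologicalSpace.countable_cover_nhdsWithin
      (s := Zᶜ) (f := fun p => toCompletion d ⁻¹' W p) fun p hp =>
        mem_nhdsWithin_of_mem_nhds (((hWo p hp).preimage hemb.continuous).mem_nhds (hpW p hp))
    have := htc.to_subtype
    refine Measure.le_of_countable_cover (fun p : t => W p)
      (fun p => (hWo p (htZ p.2)).measurableSet) ?_ fun p s hs => ?_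
    · rw [Measure.smul_apply, hemb.measurableEmbedding.map_apply, smul_eq_mul]
      refine mul_eq_zero_of_right _ (measure_mono_null (fun x hx => ?_) hZ)
      by_contra hxZ
      obtain ⟨p, hp, hxp⟩ := Set.mem_iUnion₂.1 (hcov hxZ)
      exact hx (Set.mem_iUnion.2 ⟨⟨p, hp⟩, hxp⟩)
    · rw [Measure.smul_apply, smul_eq_mul]
      exact hW p (htZ p.2) s hs
  rw [Measure.le_iff]
  intro s hs
  rw [Measure.smul_apply, smul_eq_mul]
  have hlim : Filter.Tendsto (fun c => ENNReal.ofReal c) (𝓝[<] C) (𝓝 (ENNReal.ofReal C)) :=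
    (ENNReal.continuous_ofReal.tendsto C).mono_left nhdsWithin_le_nhds
  refine le_of_tendsto (ENNReal.Tendsto.mul_const hlim (Or.inl (by simpa using hC))) ?_
  filter_upwards [Ioo_mem_nhdsLT hC] with c hc
  have := Measure.le_iff.1 (hstep c hc.1.le hc.2) s hs
  rwa [Measure.smul_apply, smul_eq_mul] at this

end

end C0Riemannian

/-! ### Upper bounds, and functions with prescribed gradients -/

namespace C0Riemannian

section

variable {m : ℕ} {H : Type*} [TopologicalSpace H]
  {I : ModelWithCorners ℝ (EuclideanSpace ℝ (Fin m)) H}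
  {M : Type*} [TopologicalSpace M] [ChartedSpace H M] [IsManifold I ∞ M]
  [RiemannianBundle (fun x : M => TangentSpace I x)]

variable [T2Space M]
  [IsContinuousRiemannianBundle (EuclideanSpace ℝ (Fin m)) (fun x : M => TangentSpace I x)]

omit [T2Space M]
  [IsContinuousRiemannianBundle (EuclideanSpace ℝ (Fin m)) (fun x : M => TangentSpace I x)] in
/-- In a chart the boundary lies in the frontier of the convex set `range I`, which is null. -/
lemma chartVolume_boundary [MeasurableSpace M] [BorelSpace M] (x₀ : M) :
    chartVolume I x₀ (I.boundary M) = 0 := by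
  have hmeas : MeasurableSet (I.boundary M) :=
    (I.isClosed_boundary (M := M) (n := ∞) (by simp)).measurableSet
  rw [chartVolume]
  -- If the parametrization were not measurable, the pushforward would be zero by convention.
  by_cases hae : AEMeasurable (extChartAt I x₀).symm ((volume.restrict
      (extChartAt I x₀).target).withDensity
        (fun y => ENNReal.ofReal (volumeDensity I x₀ ((extChartAt I x₀).symm y))))
  swap
  · rw [Measure.map_of_not_aemeasurable hae]
    rfl
  rw [Measure.map_apply_of_aemeasurable hae hmeas]
  refine withDensity_absolutelyContinuous _ _ ?_
  refine Measure.restrict_apply_eq_zero' ?_ |>.2 ?_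
  · rw [extChartAt_target]
    exact ((chartAt H x₀).open_target.preimage I.continuous_symm).measurableSet.inter
      I.isClosed_range.measurableSet
  refine measure_mono_null ?_ (I.convex_range.addHaar_frontier volume)
  rintro y ⟨hy, hyt⟩
  have hsrc : (extChartAt I x₀).symm y ∈ (chartAt H x₀).source := by
    rw [← extChartAt_source I]
    exact (extChartAt I x₀).map_target hyt
  refine ⟨subset_closure (extChartAt_target_subset_range x₀ hyt), fun hint => ?_⟩
  have h1 : ¬ I.IsInteriorPoint ((extChartAt I x₀).symm y) :=
    (I.isBoundaryPoint_iff_not_isInteriorPoint _).1 hy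
  apply h1
  rw [I.isInteriorPoint_iff_of_mem_atlas (n := ∞) (by simp) (chart_mem_atlas H x₀) hsrc]
  refine (chartAt H x₀).mem_interior_extend_target ((chartAt H x₀).map_source hsrc) ?_
  have h2 : (chartAt H x₀).extend I ((extChartAt I x₀).symm y) = y :=
    (extChartAt I x₀).right_inv hyt
  rwa [← h2] at hint

omit [T2Space M]
  [IsContinuousRiemannianBundle (EuclideanSpace ℝ (Fin m)) (fun x : M => TangentSpace I x)] in
variable (I M) in
lemma riemannianVolume_boundary [MeasurableSpace M] [BorelSpace M] :
    riemannianVolume I M (I.boundary M) = 0 := by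
  have hmeas : MeasurableSet (I.boundary M) :=
    (I.isClosed_boundary (M := M) (n := ∞) (by simp)).measurableSet
  -- Each chart measure lives on the interior, hence so does their supremum.
  have hle : riemannianVolume I M ≤ (riemannianVolume I M).restrict (I.boundary M)ᶜ := by
    refine iSup_le fun x₀ => ?_
    have h1 : (chartVolume I x₀).restrict (I.boundary M)ᶜ = chartVolume I x₀ :=
      Measure.restrict_eq_self_of_ae_mem (compl_mem_ae_iff.2 (chartVolume_boundary x₀))
    rw [← h1]
    exact Measure.restrict_mono le_rfl (le_iSup (fun x₀ => chartVolume I x₀) x₀)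
  refine le_antisymm ((Measure.le_iff.1 hle _ hmeas).trans_eq ?_) bot_le
  rw [Measure.restrict_apply hmeas, Set.inter_compl_self, measure_empty]

/-- Hadamard's inequality and the bound on differentials of Lipschitz functions; the boundary is
null. -/
lemma abs_apply_le_of_lipschitzWith [MeasurableSpace M] [BorelSpace M]
    {o : ManifoldOrientation I M} {d : MetricSpace M} (hd : LocallyCompatible I d)
    {T : Functional (UniformSpace.Completion (WithMetric M d)) m} (hT : IsCanonicalCurrent I o d T)
    [IsFiniteMeasure ((riemannianVolume I M).map (toCompletion d))]
    (f : BLip (UniformSpace.Completion (WithMetric M d)))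
    (q : Fin m → Lip (UniformSpace.Completion (WithMetric M d))) (K : Fin m → ℝ≥0)
    (hq : ∀ i, LipschitzWith (K i) (q i).1) :
    |T f q| ≤ (∏ i, (K i : ℝ)) * ∫ x, |f.1 x| ∂(riemannianVolume I M).map (toCompletion d) := by
  have hemb := hd.isOpenEmbedding_toCompletion
  obtain ⟨L, hL⟩ := f.2.1
  obtain ⟨C, hC⟩ := f.2.2
  have hfi : Integrable (fun x => |f.1 x|) ((riemannianVolume I M).map (toCompletion d)) := by
    refine Integrable.of_bound hL.continuous.abs.aestronglyMeasurable C (ae_of_all _ fun x => ?_)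
    rw [Real.norm_eq_abs, abs_abs]
    exact hC x
  rw [hemb.measurableEmbedding.integrable_map_iff] at hfi
  rw [hemb.measurableEmbedding.integral_map, (hT f q).2, ← integral_const_mul,
    ← Real.norm_eq_abs]
  refine norm_integral_le_of_norm_le (hfi.const_mul _) ?_
  have hint : ∀ᵐ x ∂riemannianVolume I M, x ∉ I.boundary M :=
    compl_mem_ae_iff.2 (riemannianVolume_boundary I M)
  filter_upwards [hint] with x hx
  rw [Real.norm_eq_abs, abs_mul, mul_comm]
  refine mul_le_mul_of_nonneg_right ?_ (abs_nonneg _)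
  refine (abs_formCoeff_le o _ x).trans (Finset.prod_le_prod 
    (fun _ _ => ContinuousLinearMap.opNorm_nonneg _) ?_)
  intro i _
  have hxi : I.IsInteriorPoint x := by
    by_contra h
    exact hx ((I.isBoundaryPoint_iff_not_isInteriorPoint _).2 h)
  refine norm_covector_le_of_isInteriorPoint hxi ?_
  obtain ⟨U, hU, hUd⟩ := hd.eventually_edist_eq x
  filter_upwards [hU] with y hy
  rw [← hUd x (mem_of_mem_nhds hU) y hy]
  exact hq i _ _

omit [T2Space M]
  [IsContinuousRiemannianBundle (EuclideanSpace ℝ (Fin m)) (fun x : M => TangentSpace I x)] in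
/-- Equality in Hadamard's inequality for orthogonal gradients. -/
lemma abs_formCoeff_eq_of_pairwise_orthogonal (o : ManifoldOrientation I M) {q : Fin m → M → ℝ}
    {x : M} (v : Fin m → TangentSpace I x) (hv : Pairwise fun i j => inner ℝ (v i) (v j) = 0)
    (hq : ∀ i w, covector I (q i) x w = inner ℝ (v i) w) :
    |formCoeff I o q x| = ∏ i, ‖v i‖ := by
  have := FiniteDimensional.complete ℝ (TangentSpace I x)
  rw [formCoeff_eq_volumeForm, ← (o.at' x).abs_volumeForm_apply_of_pairwise_orthogonal hv]
  congr 2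
  ext1 i
  rw [LinearIsometryEquiv.symm_apply_eq]
  ext w
  exact hq i w

/-- Every vector of norm less than one is the gradient of a `1`-Lipschitz function. -/
lemma exists_lip_gradient_eq {d : MetricSpace M} (hd : LocallyCompatible I d) {p : M}
    (v : TangentSpace I p) (hv : ‖v‖ < 1) :
    ∃ ρ : Lip (UniformSpace.Completion (WithMetric M d)),
      LipschitzWith 1 (ρ : UniformSpace.Completion (WithMetric M d) → ℝ) ∧
      ContMDiffAt I 𝓘(ℝ, ℝ) 1 (ρ.1 ∘ toCompletion d) p ∧
      ∀ w, covector I (ρ.1 ∘ toCompletion d) p w = inner ℝ v w := by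
  obtain ⟨ρ, h1, h2, h3⟩ := exists_lip_eq_chart hd p (innerSL ℝ v)
    ((innerSL_apply_norm (𝕜 := ℝ) v).trans_lt hv)
  exact ⟨ρ, h1, h2, fun w => by rw [h3, innerSL_apply_apply]⟩

lemma _root_.Real.exists_lt_mul_pow_of_lt {c C : ℝ} (h : c < C) (k : ℕ) :
    ∃ t : ℝ, 0 < t ∧ t < 1 ∧ c < C * t ^ k := by
  have hlim : Filter.Tendsto (fun t : ℝ => C * t ^ k) (𝓝[<] 1) (𝓝 (C * 1 ^ k)) :=
    ((continuous_const.mul (continuous_pow k)).tendsto 1).mono_left nhdsWithin_le_nhds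
  rw [one_pow, mul_one] at hlim
  obtain ⟨t, ht, ht'⟩ := ((hlim.eventually (lt_mem_nhds h)).and
    (Ioo_mem_nhdsLT (zero_lt_one' ℝ))).exists
  exact ⟨t, ht'.1, ht'.2, ht⟩

lemma volume_le_of_massBound [SecondCountableTopology M] [MeasurableSpace M] [BorelSpace M]
    {o : ManifoldOrientation I M} {d : MetricSpace M} (hd : LocallyCompatible I d)
    {T : Functional (UniformSpace.Completion (WithMetric M d)) m} (hT : IsCanonicalCurrent I o d T)
    {μ : Measure (UniformSpace.Completion (WithMetric M d))} [IsFiniteMeasure μ]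
    (hμ : MassBound T μ) : (riemannianVolume I M).map (toCompletion d) ≤ μ := by
  rw [← one_smul ℝ≥0∞ ((riemannianVolume I M).map (toCompletion d)), ← ENNReal.ofReal_one]
  refine ofReal_smul_volume_le_of_forall_exists_nhds hd (Z := ∅) measure_empty one_pos ?_
  intro c hc0 hc p _
  obtain ⟨t, ht0, ht1, hct⟩ := Real.exists_lt_mul_pow_of_lt hc m
  obtain ⟨b⟩ := Orientation.exists_orthonormalBasis_fin (V := TangentSpace I p) (m := m) Fact.out
  have hnorm : ∀ i, ‖t • b i‖ = t := fun i => by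
    rw [norm_smul, b.norm_eq_one, mul_one, Real.norm_of_nonneg ht0.le]
  choose ρ h1 h2 h3 using fun i => exists_lip_gradient_eq hd (t • b i) ((hnorm i).trans_lt ht1)
  refine exists_nhds_volume_le_of_lt_formCoeff hd hT ρ (fun f => hμ f ρ h1) h2 hc0 ?_
  rw [abs_formCoeff_eq_of_pairwise_orthogonal o (fun i => t • b i) (fun i j hij => ?_) h3]
  · simpa [hnorm] using hct
  · simp only [inner_smul_left, inner_smul_right, b.orthonormal.2 hij, mul_zero]

end

section

variable {k : ℕ} {H : Type*} [TopologicalSpace H]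
  {I : ModelWithCorners ℝ (EuclideanSpace ℝ (Fin (k + 1))) H}
  {M : Type*} [TopologicalSpace M] [ChartedSpace H M] [IsManifold I ∞ M]
  [RiemannianBundle (fun x : M => TangentSpace I x)] [T2Space M]
  [IsContinuousRiemannianBundle (EuclideanSpace ℝ (Fin (k + 1))) (fun x : M => TangentSpace I x)]

/-- Complete the direction of `∇u` to an orthonormal basis and use coordinates in the remaining
directions: the form `du ∧ dπ₁ ∧ … ∧ dπₖ` then has size almost `|∇u|`. -/
lemma volume_le_of_massBound_restrictD [SecondCountableTopology M] [MeasurableSpace M]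
    [BorelSpace M] {o : ManifoldOrientation I M} {d : MetricSpace M} (hd : LocallyCompatible I d)
    {T : Functional (UniformSpace.Completion (WithMetric M d)) (k + 1)}
    (hT : IsCanonicalCurrent I o d T)
    (u : Lip (UniformSpace.Completion (WithMetric M d))) {S : Set M} (hS : IsClosed S)
    (hS0 : riemannianVolume I M S = 0)
    (hu : ContMDiffOn I 𝓘(ℝ, ℝ) 1 (u.1 ∘ toCompletion d) Sᶜ) {C : ℝ} (hC : 0 < C)
    (hgrad : ∀ x ∈ Sᶜ, C ≤ ‖riemannianGradient I (u.1 ∘ toCompletion d) x‖)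
    {μ : Measure (UniformSpace.Completion (WithMetric M d))} [IsFiniteMeasure μ]
    (hμ : MassBound (restrictD T u) μ) :
    ENNReal.ofReal C • (riemannianVolume I M).map (toCompletion d) ≤ μ := by
  refine ofReal_smul_volume_le_of_forall_exists_nhds hd hS0 hC ?_
  intro c hc0 hc p hp
  obtain ⟨t, ht0, ht1, hct⟩ := Real.exists_lt_mul_pow_of_lt hc k
  set g := riemannianGradient I (u.1 ∘ toCompletion d) p with hg
  have hgpos : 0 < ‖g‖ := hC.trans_le (hgrad p hp)
  have hcard : Module.finrank ℝ (TangentSpace I p) = Fintype.card (Fin (k + 1)) := by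
    rw [Fintype.card_fin]
    exact Fact.out
  obtain ⟨b, hb⟩ : ∃ b : OrthonormalBasis (Fin (k + 1)) ℝ (TangentSpace I p),
      b 0 = ‖g‖⁻¹ • g := by
    have hon : Orthonormal ℝ (({0} : Set (Fin (k + 1))).domRestrict fun _ => ‖g‖⁻¹ • g) := by
      refine ⟨fun i => ?_, fun i j hij => (hij (Subsingleton.elim i j)).elim⟩
      rw [Set.domRestrict_apply, norm_smul, norm_inv, norm_norm, inv_mul_cancel₀ hgpos.ne']
    obtain ⟨b, hb⟩ := hon.exists_orthonormalBasis_extension_of_card_eq hcard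
    exact ⟨b, hb 0 rfl⟩
  have hgb : g = ‖g‖ • b 0 := by
    rw [hb, smul_smul, mul_inv_cancel₀ hgpos.ne', one_smul]
  have hnorm : ∀ i, ‖t • b i‖ = t := fun i => by
    rw [norm_smul, b.norm_eq_one, mul_one, Real.norm_of_nonneg ht0.le]
  choose ρ h1 h2 h3 using fun i : Fin k =>
    exists_lip_gradient_eq hd (t • b i.succ) ((hnorm i.succ).trans_lt ht1)
  refine exists_nhds_volume_le_of_lt_formCoeff hd hT (Fin.cons u ρ) (fun f => hμ f ρ h1) ?_ hc0 ?_
  · refine Fin.cases ?_ h2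
    exact hu.contMDiffAt (hS.isOpen_compl.mem_nhds hp)
  · rw [abs_formCoeff_eq_of_pairwise_orthogonal o (Fin.cons g fun i => t • b i.succ) ?_ ?_]
    · rw [Fin.prod_univ_succ]
      simp only [Fin.cons_zero, Fin.cons_succ, hnorm, Finset.prod_const, Finset.card_univ,
        Fintype.card_fin]
      exact hct.trans_le (mul_le_mul_of_nonneg_right (hgrad p hp) (by positivity))
    · have hform : ∀ i : Fin (k + 1), ∃ a : ℝ,
          (Fin.cons g (fun i => t • b i.succ) : Fin (k + 1) → TangentSpace I p) i = a • b i :=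
        Fin.cases ⟨‖g‖, hgb⟩ fun i => ⟨t, rfl⟩
      intro i j hij
      obtain ⟨a, ha⟩ := hform i
      obtain ⟨a', ha'⟩ := hform j
      simp only [ha, ha', inner_smul_left, inner_smul_right, b.orthonormal.2 hij, mul_zero]
    · refine Fin.cases (fun w => ?_) h3
      have := FiniteDimensional.complete ℝ (TangentSpace I p)
      rw [Fin.cons_zero, hg, riemannianGradient]
      exact (InnerProductSpace.toDual_symm_apply (𝕜 := ℝ)).symm

end

end C0Riemannian

/-! ### Mass measures -/

namespace C0Riemannian

section

variable {m : ℕ} {H : Type*} [TopologicalSpace H]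
  {I : ModelWithCorners ℝ (EuclideanSpace ℝ (Fin m)) H}
  {M : Type*} [TopologicalSpace M] [ChartedSpace H M] [IsManifold I ∞ M]
  [RiemannianBundle (fun x : M => TangentSpace I x)] [T2Space M] [SecondCountableTopology M]
  [IsContinuousRiemannianBundle (EuclideanSpace ℝ (Fin m)) (fun x : M => TangentSpace I x)]
  [MeasurableSpace M] [BorelSpace M]

lemma massMeasure_eq_map_volume {o : ManifoldOrientation I M} {d : MetricSpace M}
    (hd : LocallyCompatible I d)
    {T : Functional (UniformSpace.Completion (WithMetric M d)) m} (hT : IsCanonicalCurrent I o d T)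
    [IsFiniteMeasure ((riemannianVolume I M).map (toCompletion d))] :
    massMeasure T = (riemannianVolume I M).map (toCompletion d) := by
  refine le_antisymm (sInf_le ⟨inferInstance, fun f p hp => ?_⟩) (le_sInf ?_)
  · simpa using abs_apply_le_of_lipschitzWith hd hT f p (fun _ => 1) hp
  · rintro μ ⟨_, hμ⟩
    exact volume_le_of_massBound hd hT hμ

end

section

variable {k : ℕ} {H : Type*} [TopologicalSpace H]
  {I : ModelWithCorners ℝ (EuclideanSpace ℝ (Fin (k + 1))) H}
  {M : Type*} [TopologicalSpace M] [ChartedSpace H M] [IsManifold I ∞ M]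
  [RiemannianBundle (fun x : M => TangentSpace I x)] [T2Space M] [SecondCountableTopology M]
  [IsContinuousRiemannianBundle (EuclideanSpace ℝ (Fin (k + 1))) (fun x : M => TangentSpace I x)]
  [MeasurableSpace M] [BorelSpace M]

omit [SecondCountableTopology M] in
lemma massMeasure_restrictD_le {o : ManifoldOrientation I M} {d : MetricSpace M}
    (hd : LocallyCompatible I d)
    {T : Functional (UniformSpace.Completion (WithMetric M d)) (k + 1)}
    (hT : IsCanonicalCurrent I o d T)
    [IsFiniteMeasure ((riemannianVolume I M).map (toCompletion d))]
    (u : Lip (UniformSpace.Completion (WithMetric M d))) {K : ℝ≥0} (hu : LipschitzWith K u.1) :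
    massMeasure (restrictD T u) ≤ (K : ℝ≥0∞) • (riemannianVolume I M).map (toCompletion d) := by
  refine sInf_le ⟨Measure.smul_finite _ ENNReal.coe_ne_top, fun f p hp => ?_⟩
  have h := abs_apply_le_of_lipschitzWith hd hT f (Fin.cons u p)
    (Fin.cons K fun _ : Fin k => 1) (Fin.cases hu hp)
  rw [integral_smul_measure]
  rw [Fin.prod_univ_succ] at h
  change |T f (Fin.cons u p)| ≤ _
  simpa using h

end

end C0Riemannian

theorem mainTheorem5 :
    ∃ γ₀ : ℝ, 0 < γ₀ ∧
    ∀ (m : ℕ) (H : Type*) [TopologicalSpace H]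
      (I : ModelWithCorners ℝ (EuclideanSpace ℝ (Fin m)) H)
      (M : Type*) [TopologicalSpace M] [T2Space M] [SecondCountableTopology M] [ConnectedSpace M]
      [MeasurableSpace M] [BorelSpace M]
      [ChartedSpace H M] [IsManifold I ∞ M]
      [RiemannianBundle (fun x : M => TangentSpace I x)]
      [IsContinuousRiemannianBundle (EuclideanSpace ℝ (Fin m)) (fun x : M => TangentSpace I x)]
      (o : ManifoldOrientation I M) (d : MetricSpace M)
      (T : Functional (UniformSpace.Completion (WithMetric M d)) m),
      LocallyCompatible I d →
      IsIntegralCurrentSpace (WithMetric M d) T →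
      IsCanonicalCurrent I o d T →
      -- (a)
      ((∀ s : Set M, MeasurableSet s →
          massMeasure T (toCompletion d '' s) = riemannianVolume I M s) ∧
        mass T = riemannianVolume I M Set.univ) ∧
      -- (b)
      (1 ≤ m → ∀ γ : ℝ, 0 ≤ γ → γ ≤ γ₀ →
        ∀ (u : M → ℝ)
          (hu : LipschitzWith (Real.toNNReal (1 + γ)) (u ∘ (toMetric d).symm))
          (S : Set M), IsClosed S → riemannianVolume I M S = 0 →
          ContMDiffOn I 𝓘(ℝ, ℝ) 1 u Sᶜ →
          (∀ x ∈ Sᶜ, (1 + γ)⁻¹ ≤ ‖riemannianGradient I u x‖ ∧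
            ‖riemannianGradient I u x‖ ≤ 1 + γ) →
          (∀ s : Set M, MeasurableSet s →
            ENNReal.ofReal ((1 + γ)⁻¹) * riemannianVolume I M s
                ≤ massMeasure (restrictD T (extendLip _ ⟨_, hu⟩)) (toCompletion d '' s) ∧
            massMeasure (restrictD T (extendLip _ ⟨_, hu⟩)) (toCompletion d '' s)
                ≤ ENNReal.ofReal (1 + γ) * riemannianVolume I M s) ∧
          (γ = 0 → ∀ s : Set M, MeasurableSet s →
            massMeasure (restrictD T (extendLip _ ⟨_, hu⟩)) (toCompletion d '' s)
              = riemannianVolume I M s)) := by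
  -- The argument needs no smallness of `γ`, so any positive constant would do.
  refine ⟨1, one_pos, ?_⟩
  intro m H _ I M _ _ _ _ _ _ _ _ _ _ o d T hd hspace hT
  have hemb := hd.isOpenEmbedding_toCompletion
  -- `μ_g` is finite because it lies below any of the finite measures that bound `T`.
  have hfin : IsFiniteMeasure ((riemannianVolume I M).map (toCompletion d)) := by
    obtain ⟨μ, hμfin, hμ⟩ := hspace.1.1.1.finite_mass
    exact isFiniteMeasure_of_le μ (volume_le_of_massBound hd hT hμ)
  have himage : ∀ s : Set M,
      (riemannianVolume I M).map (toCompletion d) (toCompletion d '' s) =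
        riemannianVolume I M s := fun s => by
    rw [hemb.measurableEmbedding.map_apply, Set.preimage_image_eq _ hemb.injective]
  refine ⟨⟨fun s _ => ?_, ?_⟩, ?_⟩
  · rw [massMeasure_eq_map_volume hd hT, himage]
  · rw [mass, massMeasure_eq_map_volume hd hT, hemb.measurableEmbedding.map_apply,
      Set.preimage_univ]
  intro hm γ hγ0 _ u hu S hS hS0 huS hgrad
  obtain ⟨k, rfl⟩ := Nat.exists_eq_add_of_le' hm
  have hext : (extendLip _ ⟨_, hu⟩ : Lip (UniformSpace.Completion (WithMetric M d))).1 ∘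
      toCompletion d = u := by
    ext x
    exact UniformSpace.Completion.extension_coe hu.uniformContinuous (toMetric d x)
  have hpos : 0 < 1 + γ := by linarith
  have hupper := massMeasure_restrictD_le hd hT (extendLip _ ⟨_, hu⟩) hu.completion_extension
  have hlower : ENNReal.ofReal (1 + γ)⁻¹ • (riemannianVolume I M).map (toCompletion d) ≤
      massMeasure (restrictD T (extendLip _ ⟨_, hu⟩)) := by
    refine le_sInf ?_
    rintro μ ⟨_, hμ⟩
    refine volume_le_of_massBound_restrictD hd hT _ hS hS0 ?_ (inv_pos.2 hpos) ?_ hμ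
    · rwa [hext]
    · rw [hext]
      exact fun x hx => (hgrad x hx).1
  have hbounds : ∀ s : Set M,
      ENNReal.ofReal ((1 + γ)⁻¹) * riemannianVolume I M s
          ≤ massMeasure (restrictD T (extendLip _ ⟨_, hu⟩)) (toCompletion d '' s) ∧
      massMeasure (restrictD T (extendLip _ ⟨_, hu⟩)) (toCompletion d '' s)
          ≤ ENNReal.ofReal (1 + γ) * riemannianVolume I M s := by
    intro s
    have h1 := Measure.le_iff'.1 hlower (toCompletion d '' s)
    have h2 := Measure.le_iff'.1 hupper (toCompletion d '' s)
    rw [Measure.smul_apply, himage, smul_eq_mul] at h1 h2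
    exact ⟨h1, h2⟩
  refine ⟨fun s _ => hbounds s, ?_⟩
  rintro rfl s _
  have h := hbounds s
  simp only [add_zero, inv_one, ENNReal.ofReal_one, one_mul] at h
  exact le_antisymm h.2 h.1
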